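/- Let $\mathcal H$ be a complex Hilbert space (inner product antilinear in the first argument), and let $\mathcal A=\mathrm{CAR}(\mathcal H)$ be the universal unital C*-algebra generated by elements $a(f)$, $f\in\mathcal H$, with $f\mapsto a(f)$ antilinear and $$a(f)a(g)+a(g)a(f)=0,\qquad a(f)a(g)^*+a(g)^*a(f)=\langle f,g\rangle\mathbf 1 .$$ Let $\rho=(\rho_t)_{t\in\mathbb R}$ be the strongly continuous one-parameter group of *-automorphisms of $\mathcal A$ with $\rho_t(a(f))=e^{-\mathrm i t}a(f)$, and let $\delta^\rho(x)=\lim_{t\to0^+}\frac1t(\rho_t(x)-x)$ be its generator, with domain $\mathcal D(\delta^\rho)$ the set of $x\in\mathcal A$ for which this norm limit exists. A pair $(\omega_1,\omega_2)$ of pure states of $\mathcal A$ is called $\rho$-locally-comparable if there is a unitary $u\in\mathcal A\cap\mathcal D(\delta^\rho)$ with $\omega_2(x)=\omega_1(u^*xu)$ for all $x\in\mathcal A$. If moreover $\omega_1,\omega_2$ are $\rho$-invariant, put $\mathcal N_\rho(\omega_1,\omega_2)=\mathrm i\,\omega_1(u^*\delta^\rho(u))$ for any such $u$. For an orthogonal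 projection $P$ on $\mathcal H$, the quasi-free state $\omega_P$ is the unique continuous linear functional on $\mathcal A$ with $$\omega_P\bigl(a(f_1)^*\cdots a(f_m)^*a(g_n)\cdots a(g_1)\bigr)=\delta_{n,m}\det\bigl(\langle g_i,Pf_j\rangle\bigr)_{i,j=1}^n$$ for all $m,n\ge 0$ and $f_i,g_j\in\mathcal H$. **Theorem.** Let $P_1,P_2$ be orthogonal projections on $\mathcal H$ such that $P_1-P_2$ is trace class. Then the quasi-free functionals $\omega_{P_1},\omega_{P_2}$ exist and are unique, they are $\rho$-invariant pure states, and $(\omega_{P_1},\omega_{P_2})$ is $\rho$-locally-comparable. The operator $P_2P_1|_{\operatorname{im}P_1}:\operatorname{im}P_1\to\operatorname{im}P_2$ is Fredholm, the number $\mathrm i\,\omega_{P_1}(u^*\delta^\rho(u))$ does not depend on the choice of the unitary $u$ above, and $$\mathcal N_\rho(\omega_{P_1},\omega_{P_2})=\operatorname{index}(P_1,P_2):=\dim\ker\bigl(P_2P_1|_{\operatorname{im}P_1}\bigr)-\dim\operatorname{coker}\bigl(P_2P_1|_{\operatorname{im}P_1}\bigr).$$ -/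

import Mathlib

open Filter Topology
open scoped ENNReal ComplexOrder InnerProductSpace

universe u

noncomputable section

/-! ### States, flows and the index of a pair of states on a unital C*-algebra -/

section Abstract

variable {A : Type*} [CStarAlgebra A]

/-- The states of `A`: positive linear functionals `ω` with `ω 1 = 1`. (Positive functionals on a
C*-algebra are automatically continuous, so nothing is lost by working inside the dual space.) -/
def stateSpace (A : Type*) [CStarAlgebra A] : Set (A →L[ℂ] ℂ) :=
  {ω | (∀ a : A, 0 ≤ ω (star a * a)) ∧ ω 1 = 1}

/-- The pure states of `A`: the extreme points of the state space. -/
def pureStates (A : Type*) [CStarAlgebra A] : Set (A →L[ℂ] ℂ) :=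
  Set.extremePoints ℝ (stateSpace A)

/-- A strongly continuous one-parameter group of *-automorphisms of `A`. -/
structure AutFlow (A : Type*) [CStarAlgebra A] where
  /-- the automorphism at time `t` -/
  aut : ℝ → A ≃⋆ₐ[ℂ] A
  aut_zero : ∀ a, aut 0 a = a
  aut_add : ∀ s t a, aut (s + t) a = aut s (aut t a)
  continuous_aut : ∀ a, Continuous fun t => aut t a

/-- `ρ.HasGenerator a b` says that `a` is in the domain of the generator `δ` of `ρ`, and that
`δ a = b`, i.e. `(ρ_t(a) - a) / t → b` in norm as `t → 0+`. -/
def AutFlow.HasGenerator (ρ : AutFlow A) (a b : A) : Prop :=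
  Tendsto (fun t : ℝ => t⁻¹ • (ρ.aut t a - a)) (𝓝[>] 0) (𝓝 b)

/-- The domain of the generator `δ` of `ρ`. -/
def AutFlow.domain (ρ : AutFlow A) : Set A :=
  {a | ∃ b, ρ.HasGenerator a b}

open Classical in
/-- The generator `δ` of `ρ`, extended by zero outside its domain. -/
def AutFlow.generator (ρ : AutFlow A) (a : A) : A :=
  if h : a ∈ ρ.domain then h.choose else 0

/-- The state (or functional) `ω` is invariant under `ρ`. -/
def AutFlow.Invariant (ρ : AutFlow A) (ω : A →L[ℂ] ℂ) : Prop :=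
  ∀ t a, ω (ρ.aut t a) = ω a

/-- The unitaries `u` in the domain of `δ` with `ω₂ = ω₁ ∘ Ad u`, where `Ad u a = u* a u`. -/
def AutFlow.intertwiners (ρ : AutFlow A) (ω₁ ω₂ : A →L[ℂ] ℂ) : Set A :=
  {u | u ∈ unitary A ∧ u ∈ ρ.domain ∧ ∀ a, ω₂ a = ω₁ (star u * a * u)}

/-- `(ω₁, ω₂)` is a `ρ`-locally-comparable pair of pure states. -/
def AutFlow.LocallyComparable (ρ : AutFlow A) (ω₁ ω₂ : A →L[ℂ] ℂ) : Prop :=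
  ω₁ ∈ pureStates A ∧ ω₂ ∈ pureStates A ∧ (ρ.intertwiners ω₁ ω₂).Nonempty

open Classical in
/-- The index `N_ρ(ω₁, ω₂) = i ω₁(u* δ(u))`, for some choice of a unitary `u` in the domain of `δ`
with `ω₂ = ω₁ ∘ Ad u` (and `0` if there is none). -/
def AutFlow.index (ρ : AutFlow A) (ω₁ ω₂ : A →L[ℂ] ℂ) : ℂ :=
  if h : (ρ.intertwiners ω₁ ω₂).Nonempty then
    Complex.I * ω₁ (star h.some * ρ.generator h.some)
  else 0

end Abstract

/-! ### The CAR algebra -/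

section CAR

/-- Annihilation operators over `H` in some nonzero unital C*-algebra: an antilinear map
`f ↦ a f` satisfying the canonical anticommutation relations. -/
structure CARSystem (H : Type u) [NormedAddCommGroup H] [InnerProductSpace ℂ H] :
    Type (u + 1) where
  /-- the C*-algebra -/
  Alg : Type u
  [cstar : CStarAlgebra Alg]
  [nontriv : Nontrivial Alg]
  /-- the annihilation operators -/
  a : H →ₗ⋆[ℂ] Alg
  anticomm : ∀ f g, a f * a g + a g * a f = 0
  anticomm_star : ∀ f g, a f * star (a g) + star (a g) * a f = ⟪f, g⟫_ℂ • (1 : Alg)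

attribute [instance] CARSystem.cstar CARSystem.nontriv

variable {H : Type u} [NormedAddCommGroup H] [InnerProductSpace ℂ H]

theorem StarAlgHom.continuous_of_cstar {A B : Type*} [CStarAlgebra A] [CStarAlgebra B]
    (φ : A →⋆ₐ[ℂ] B) : Continuous φ :=
  AddMonoidHomClass.continuous_of_bound φ 1 fun x => by
    simpa using NonUnitalStarAlgHom.norm_apply_le φ x

theorem CARSystem.norm_a_le (c : CARSystem H) (f : H) : ‖c.a f‖ ≤ ‖f‖ := by
  have hsq : c.a f * c.a f = 0 := by
    have h := c.anticomm f f
    rw [← two_smul ℂ] at h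
    exact (smul_eq_zero.mp h).resolve_left two_ne_zero
  have hx : star (star (c.a f) * c.a f) * (star (c.a f) * c.a f)
      = ⟪f, f⟫_ℂ • (star (c.a f) * c.a f) := by
    have h := c.anticomm_star f f
    calc star (star (c.a f) * c.a f) * (star (c.a f) * c.a f)
        = star (c.a f) * (c.a f * star (c.a f) + star (c.a f) * c.a f) * c.a f
            - star (c.a f) * star (c.a f) * (c.a f * c.a f) := by
          simp only [star_mul, star_star]; noncomm_ring
      _ = ⟪f, f⟫_ℂ • (star (c.a f) * c.a f) := by
          rw [h, hsq]; simp
  have hn := congrArg norm hx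
  rw [CStarRing.norm_star_mul_self, norm_smul, CStarRing.norm_star_mul_self,
    inner_self_eq_norm_sq_to_K] at hn
  simp only [Complex.coe_algebraMap, norm_pow, Complex.norm_real, norm_norm] at hn
  by_contra! hlt
  have h0 : 0 ≤ ‖f‖ := norm_nonneg f
  have h1 : 0 < ‖c.a f‖ := h0.trans_lt hlt
  have h2 : ‖c.a f‖ * ‖c.a f‖ = ‖f‖ ^ 2 := mul_right_cancel₀ (mul_pos h1 h1).ne' hn
  nlinarith

variable (H) in
/-- The C*-algebra of bounded families indexed by all CAR systems over `H`. -/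
abbrev CARProduct : Type (u + 1) := lp (fun c : CARSystem H => c.Alg) ∞

instance : CStarAlgebra (CARProduct H) where

/-- The family whose component in each CAR system is the annihilation operator of `f`. -/
def CARProduct.a (f : H) : CARProduct H :=
  ⟨fun c => c.a f, memℓp_infty ⟨‖f‖, by rintro _ ⟨c, rfl⟩; exact c.norm_a_le f⟩⟩

variable (H) in
/-- The closed unital *-subalgebra generated by the annihilation operators. -/
def carSubalgebra : StarSubalgebra ℂ (CARProduct H) :=
  (StarAlgebra.adjoin ℂ (Set.range (CARProduct.a (H := H)))).topologicalClosure

instance : IsClosed (carSubalgebra H : Set (CARProduct H)) :=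
  StarSubalgebra.isClosed_topologicalClosure _

variable (H) in
/-- The CAR algebra over `H`: the universal unital C*-algebra generated by elements `a f`
satisfying the canonical anticommutation relations. It is realized as the C*-algebra generated by
the family of the annihilation operators of all CAR systems, so that the norm of a polynomial in the
`a f` and their adjoints is the supremum of its norms in all CAR systems. -/
def CAR : Type (u + 1) := carSubalgebra H

instance : CStarAlgebra (CAR H) := inferInstanceAs (CStarAlgebra (carSubalgebra H))

namespace CAR

/-- The annihilation operator `a f` in the CAR algebra. -/
def a (f : H) : CAR H :=
  (⟨CARProduct.a f, StarSubalgebra.le_topologicalClosure _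
    (StarAlgebra.subset_adjoin ℂ _ ⟨f, rfl⟩)⟩ : carSubalgebra H)

/-- The component of an element of the CAR algebra in the CAR system `c`: the canonical
*-homomorphism to `c.Alg` that sends `a f` to `c.a f`. -/
def eval (c : CARSystem H) : CAR H →⋆ₐ[ℂ] c.Alg where
  toFun x := (x.1 : CARProduct H) c
  map_one' := rfl
  map_mul' _ _ := rfl
  map_zero' := rfl
  map_add' _ _ := rfl
  commutes' _ := rfl
  map_star' _ := rfl

theorem eval_a (c : CARSystem H) (f : H) : eval c (a f) = c.a f := rfl

theorem ext_eval {x y : CAR H} (h : ∀ c, eval c x = eval c y) : x = y :=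
  Subtype.ext (lp.ext (funext h))

theorem anticomm (f g : H) : a f * a g + a g * a f = 0 :=
  ext_eval fun c => by simpa [eval_a] using c.anticomm f g

theorem anticomm_star (f g : H) :
    a f * star (a g) + star (a g) * a f = ⟪f, g⟫_ℂ • (1 : CAR H) :=
  ext_eval fun c => by simpa [eval_a, map_star] using c.anticomm_star f g

/-- A *-homomorphism on the CAR algebra is determined by its values on the `a f`. -/
theorem hom_ext {B : Type*} [CStarAlgebra B] {φ ψ : CAR H →⋆ₐ[ℂ] B}
    (h : ∀ f, φ (a f) = ψ (a f)) : φ = ψ := by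
  refine StarAlgHom.ext_topologicalClosure (S := StarAlgebra.adjoin ℂ
    (Set.range (CARProduct.a (H := H)))) (φ := φ) (ψ := ψ) ?_ ?_ ?_
  · exact StarAlgHom.continuous_of_cstar φ
  · exact StarAlgHom.continuous_of_cstar ψ
  · refine StarAlgHom.ext_adjoin fun x hx => ?_
    obtain ⟨f, hf⟩ := hx
    have : x = ⟨CARProduct.a f, StarAlgebra.subset_adjoin ℂ _ ⟨f, rfl⟩⟩ := Subtype.ext hf.symm
    subst this
    exact h f

end CAR

/-- The CAR system `f ↦ z a(f)` for a phase `z`. -/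
@[reducible] def CARSystem.rotate (z : Circle) (c : CARSystem H) : CARSystem H where
  Alg := c.Alg
  a := (z : ℂ) • c.a
  anticomm f g := by
    have h := c.anticomm f g
    simp only [LinearMap.smul_apply, smul_mul_smul_comm, ← smul_add, h, smul_zero]
  anticomm_star f g := by
    have h := c.anticomm_star f g
    have hz : (z : ℂ) * star (z : ℂ) = 1 := by
      simp [Complex.mul_conj, Circle.normSq_coe]
    simp only [LinearMap.smul_apply, star_smul, smul_mul_smul_comm, mul_comm (star (z : ℂ)), hz,
      one_smul, h]

/-- Reindexing of families along `c ↦ c.rotate z`. -/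
def CARProduct.rotate (z : Circle) : CARProduct H →⋆ₐ[ℂ] CARProduct H where
  toFun x := ⟨fun c => x (c.rotate z), memℓp_infty ⟨‖x‖, by
    rintro _ ⟨c, rfl⟩
    exact lp.norm_apply_le_norm ENNReal.top_ne_zero x (c.rotate z)⟩⟩
  map_one' := rfl
  map_mul' _ _ := rfl
  map_zero' := rfl
  map_add' _ _ := rfl
  commutes' _ := rfl
  map_star' _ := rfl

namespace CAR

theorem rotate_mem (z : Circle) (x : CARProduct H) (hx : x ∈ carSubalgebra H) :
    CARProduct.rotate z x ∈ carSubalgebra H := by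
  have hcl : IsClosed ((carSubalgebra H).comap (CARProduct.rotate z) : Set (CARProduct H)) :=
    IsClosed.preimage (t := (carSubalgebra H : Set (CARProduct H)))
      (CARProduct.rotate (H := H) z).continuous_of_cstar inferInstance
  refine StarSubalgebra.topologicalClosure_minimal (StarAlgebra.adjoin_le ?_) hcl hx
  rintro _ ⟨f, rfl⟩
  have : CARProduct.rotate z (CARProduct.a f) = (z : ℂ) • CARProduct.a f := rfl
  show CARProduct.rotate z (CARProduct.a f) ∈ carSubalgebra H
  rw [this]
  exact SMulMemClass.smul_mem _ (CAR.a f).2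

/-- The *-endomorphism of the CAR algebra with `a f ↦ z a f`, for a phase `z`. -/
def rotate (z : Circle) : CAR H →⋆ₐ[ℂ] CAR H where
  toFun x := (⟨CARProduct.rotate z x.1, rotate_mem z _ x.2⟩ : carSubalgebra H)
  map_one' := rfl
  map_mul' _ _ := rfl
  map_zero' := rfl
  map_add' _ _ := rfl
  commutes' _ := rfl
  map_star' _ := rfl

theorem rotate_a (z : Circle) (f : H) : rotate z (a f) = (z : ℂ) • a f := rfl

theorem rotate_one (x : CAR H) : rotate 1 x = x := by
  have : rotate (H := H) 1 = StarAlgHom.id ℂ (CAR H) := hom_ext fun f => by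
    simp [rotate_a]
  rw [this]; rfl

theorem rotate_mul (z w : Circle) (x : CAR H) : rotate (z * w) x = rotate z (rotate w x) := by
  have : rotate (H := H) (z * w) = (rotate z).comp (rotate w) := hom_ext fun f => by
    simp [rotate_a, smul_smul, mul_comm]
  rw [this]; rfl

theorem continuous_rotate (x : CAR H) : Continuous fun z : Circle => rotate z x := by
  suffices h : ∀ y ∈ carSubalgebra H, Continuous fun z : Circle => CARProduct.rotate z y from
    (h x.1 x.2).subtype_mk fun z => rotate_mem z _ x.2
  intro y hy
  refine continuous_of_uniform_approx_of_continuous fun U hU => ?_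
  obtain ⟨ε, hε, hU⟩ := Metric.mem_uniformity_dist.mp hU
  obtain ⟨w, hw, hyw⟩ := Metric.mem_closure_iff.mp hy ε hε
  refine ⟨fun z => CARProduct.rotate z w, ?_, fun z => hU ?_⟩
  · refine StarAlgebra.adjoin_induction (p := fun v _ => Continuous fun z : Circle =>
      CARProduct.rotate z v) ?_ ?_ ?_ ?_ ?_ hw
    · rintro _ ⟨f, rfl⟩
      exact ((continuous_subtype_val.smul continuous_const) :
        Continuous fun z : Circle => (z : ℂ) • CARProduct.a f)
    · intro r
      simp only [AlgHomClass.commutes]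
      exact continuous_const
    · intro v v' _ _ hv hv'
      simp only [map_add]
      exact hv.add hv'
    · intro v v' _ _ hv hv'
      simp only [map_mul]
      exact hv.mul hv'
    · intro v _ hv
      simpa only [map_star] using hv.star
  · rw [dist_eq_norm, ← map_sub]
    refine (NonUnitalStarAlgHom.norm_apply_le _ _).trans_lt ?_
    rwa [← dist_eq_norm]

variable (H) in
/-- The charge `U(1)` action on the CAR algebra: `ρ_t(a f) = e^{-it} a f`. -/
def charge : AutFlow (CAR H) where
  aut t :=
    { rotate (H := H) (Circle.exp (-t)) with
      invFun := rotate (Circle.exp t)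
      left_inv := fun x => by
        show rotate _ (rotate _ x) = x
        rw [← rotate_mul, ← Circle.exp_add]; simp [rotate_one]
      right_inv := fun x => by
        show rotate _ (rotate _ x) = x
        rw [← rotate_mul, ← Circle.exp_add]; simp [rotate_one]
      map_smul' := fun r x => map_smul (rotate (H := H) (Circle.exp (-t))) r x }
  aut_zero x := by
    show rotate _ x = x
    simp [rotate_one]
  aut_add s t x := by
    show rotate _ x = rotate _ (rotate _ x)
    rw [← rotate_mul, ← Circle.exp_add, neg_add]
  continuous_aut x := (continuous_rotate x).comp (Circle.exp.continuous.comp continuous_neg)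

theorem charge_a (t : ℝ) (f : H) :
    (charge H).aut t (a f) = Complex.exp (-(Complex.I * t)) • a f := by
  show rotate _ (a f) = _
  rw [rotate_a, Circle.coe_exp]
  congr 2
  push_cast
  ring

theorem charge_star_a (t : ℝ) (f : H) :
    (charge H).aut t (star (a f)) = Complex.exp (Complex.I * t) • star (a f) := by
  rw [map_star, charge_a, star_smul]
  congr 1
  simp [← Complex.exp_conj]

end CAR

end CAR

/-! ### Quasi-free states -/

section QuasiFree

variable {H : Type u} [NormedAddCommGroup H] [InnerProductSpace ℂ H]

/-- `ω` is the quasi-free functional associated to `P`: it is linear and continuous, and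
`ω(a(f₁)* ⋯ a(fₘ)* a(gₙ) ⋯ a(g₁)) = δ_{nm} det (⟨gᵢ, P fⱼ⟩)`. -/
structure IsQuasiFree (P : H →L[ℂ] H) (ω : CAR H →L[ℂ] ℂ) : Prop where
  eq_det : ∀ (n : ℕ) (f g : Fin n → H),
    ω ((List.ofFn fun i => star (CAR.a (f i))).prod *
        (List.ofFn fun i => CAR.a (g i)).reverse.prod) =
      (Matrix.of fun i j => ⟪g i, P (f j)⟫_ℂ).det
  eq_zero : ∀ (m n : ℕ) (f : Fin m → H) (g : Fin n → H), m ≠ n →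
    ω ((List.ofFn fun i => star (CAR.a (f i))).prod *
        (List.ofFn fun i => CAR.a (g i)).reverse.prod) = 0

end QuasiFree

/-! ### Trace class operators and the index of a pair of projections -/

section Projections

variable {H : Type u} [NormedAddCommGroup H] [InnerProductSpace ℂ H]

/-- `T` is trace class: `∑ᵢ ⟨eᵢ, |T| eᵢ⟩ < ∞` for an orthonormal basis `(eᵢ)` of `H`, where
`|T| = (T* T)^{1/2}`. (The sum does not depend on the basis.) -/
def IsTraceClass [CompleteSpace H] (T : H →L[ℂ] H) : Prop :=
  ∃ (ι : Type u) (e : HilbertBasis ι ℂ H), Summable fun i => ‖⟪e i, CFC.abs T (e i)⟫_ℂ‖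

/-- The operator `P₂ P₁` restricted to a map from the range of `P₁` to the range of `P₂`. -/
def pairOperator (P₁ P₂ : H →L[ℂ] H) : P₁.range →L[ℂ] P₂.range :=
  ((P₂ ∘L P₁) ∘L P₁.range.subtypeL).codRestrict P₂.range fun x => ⟨P₁ x, rfl⟩

/-- The index `dim ker T - dim coker T` of a Fredholm operator `T`. -/
def fredholmIndex {E F : Type*} [NormedAddCommGroup E] [NormedSpace ℂ E] [NormedAddCommGroup F]
    [NormedSpace ℂ F] (T : E →L[ℂ] F) : ℤ :=
  (Module.finrank ℂ T.ker : ℤ) - Module.finrank ℂ (F ⧸ T.range)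

end Projections

end

/-!
For an orthogonal projection `P`, the state `ω_P` is a vacuum in which the range of `P` is filled
and its kernel is empty. It exists as a vector state of the Jordan–Wigner representation over an
orthonormal basis adapted to `P`. Every functional that satisfies the vacuum conditions and is `1`
on the unit is given by Wick's determinants, hence equals `ω_P`. The vacuum conditions pass to the
components of a convex decomposition, so that `ω_P` is pure; they only involve the two-point
function, so that `ω_P` is invariant.

The field operator `a(e) + a(e)*` of a unit vector `e` in the range of `P` is a unitary that
empties `e`: it carries `ω_P` to the state of `P - |e⟩⟨e|`, with charge `1`; its adjoint fills `e`,
with charge `-1`. Since `P₁ - P₂` is compact, `im P₁ ∩ ker P₂` and `im P₂ ∩ ker P₁` are finite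
dimensional. Emptying the first and filling the second produces the charge `dim (im P₁ ∩ ker P₂) -
dim (im P₂ ∩ ker P₁)`, which is the index. The remaining parts of the projections are in generic
position and are exchanged along pairs of principal vectors `p k`, `q k` by an infinite product of
the unitaries `field (q k) * field (p k)` of charge `0`. The product and its image under the
generator converge in norm because `‖p k - q k‖ ≤ √2 sin θ k` for the principal angles `θ k`, and
the sines are summable as `P₁ - P₂` is trace class.
-/

noncomputable section

/-! ### Pure states and conjugation by unitaries -/

section States

variable {A : Type*} [CStarAlgebra A]

theorem apply_mul_eq_zero_of_apply_star_mul_self_eq_zero {φ : A →L[ℂ] ℂ}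
    (hφ : ∀ a, 0 ≤ φ (star a * a)) {x : A} (hx : φ (star x * x) = 0) (y : A) :
    φ (y * x) = 0 ∧ φ (star x * y) = 0 := by
  let := CStarAlgebra.spectralOrder A
  have := CStarAlgebra.spectralOrderedRing A
  let f : A →ₚ[ℂ] ℂ := PositiveLinearMap.mk₀ φ.toLinearMap fun a ha => by
    obtain ⟨b, rfl⟩ := CStarAlgebra.nonneg_iff_eq_star_mul_self.mp ha
    exact hφ b
  have hnorm : ‖f.toPreGNS x‖ = 0 := by
    have h : ((‖f.toPreGNS x‖ ^ 2 : ℝ) : ℂ) = φ (star x * x) := by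
      exact_mod_cast f.preGNS_norm_sq (f.toPreGNS x)
    rw [hx] at h
    exact pow_eq_zero_iff two_ne_zero |>.mp (by exact_mod_cast h)
  have hinner : ∀ y, ⟪f.toPreGNS y, f.toPreGNS x⟫_ℂ = 0 ∧
      ⟪f.toPreGNS x, f.toPreGNS y⟫_ℂ = 0 := fun y => by
    constructor <;> refine norm_le_zero_iff.mp ((norm_inner_le_norm _ _).trans_eq ?_) <;>
      simp [hnorm]
  refine ⟨?_, (hinner y).2⟩
  have h := (hinner (star y)).1
  rwa [f.preGNS_inner_def, f.ofPreGNS_toPreGNS, star_star] at h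

theorem eq_zero_of_apply_one_eq_zero {φ : A →L[ℂ] ℂ} (hφ : ∀ a, 0 ≤ φ (star a * a))
    (h1 : φ 1 = 0) : φ = 0 := by
  ext x
  simpa using (apply_mul_eq_zero_of_apply_star_mul_self_eq_zero hφ (x := 1) (by simpa) x).1

theorem inv_smul_mem_stateSpace {φ : A →L[ℂ] ℂ} (hφ : ∀ a, 0 ≤ φ (star a * a)) (h1 : φ 1 ≠ 0) :
    (φ 1)⁻¹ • φ ∈ stateSpace A := by
  have h0 : 0 ≤ φ 1 := by simpa using hφ 1
  exact ⟨fun a => mul_nonneg (inv_nonneg_of_nonneg h0) (hφ a), inv_mul_cancel₀ h1⟩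

theorem eq_apply_one_smul_of_add_eq_smul {ω φ ψ : A →L[ℂ] ℂ} (hω : ω ∈ pureStates A)
    (hφ : ∀ a, 0 ≤ φ (star a * a)) (hψ : ∀ a, 0 ≤ ψ (star a * a)) {r : ℂ} (h : φ + ψ = r • ω) :
    φ = φ 1 • ω := by
  have hr : φ 1 + ψ 1 = r := by simpa [hω.1.2] using congrArg (fun θ => θ 1) h
  by_cases hφ1 : φ 1 = 0
  · ext x
    simp [eq_zero_of_apply_one_eq_zero hφ hφ1]
  by_cases hψ1 : ψ 1 = 0
  · rwa [← hr, hψ1, eq_zero_of_apply_one_eq_zero hψ hψ1, add_zero, add_zero] at h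
  obtain ⟨a, ha, haφ⟩ := RCLike.nonneg_iff_exists_ofReal.mp (show 0 ≤ φ 1 by simpa using hφ 1)
  obtain ⟨b, hb, hbψ⟩ := RCLike.nonneg_iff_exists_ofReal.mp (show 0 ≤ ψ 1 by simpa using hψ 1)
  have ha' : a ≠ 0 := by rintro rfl; simp [← haφ] at hφ1
  have hb' : b ≠ 0 := by rintro rfl; simp [← hbψ] at hψ1
  have hab : (a : ℂ) + b ≠ 0 := by exact_mod_cast (add_pos (by positivity) (by positivity)).ne'
  have hsegment : ω ∈ openSegment ℝ ((φ 1)⁻¹ • φ) ((ψ 1)⁻¹ • ψ) := by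
    refine ⟨a / (a + b), b / (a + b), by positivity, by positivity, by field_simp, ?_⟩
    ext x
    have hx : φ x + ψ x = (a + b) * ω x := by
      simpa [← hr, ← haφ, ← hbψ] using congrArg (fun θ => θ x) h
    have hωx : ω x = (φ x + ψ x) / (a + b) := by rw [hx, mul_div_cancel_left₀ _ hab]
    have ha'' : (a : ℂ) ≠ 0 := by exact_mod_cast ha'
    have hb'' : (b : ℂ) ≠ 0 := by exact_mod_cast hb'
    simp [← haφ, ← hbψ, hωx]
    field_simp
  have heq := (mem_extremePoints.mp hω).2 _ (inv_smul_mem_stateSpace hφ hφ1) _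
    (inv_smul_mem_stateSpace hψ hψ1) hsegment
  rw [← heq.1, smul_inv_smul₀ hφ1]

/-- The functional `x ↦ ω(u* x u)`. It is positive if `ω` is, and a state if moreover `u` is
unitary. -/
def conjFunctional (ω : A →L[ℂ] ℂ) (u : A) : A →L[ℂ] ℂ :=
  ω.comp ((ContinuousLinearMap.mul ℂ A (star u)).comp ((ContinuousLinearMap.mul ℂ A).flip u))

theorem conjFunctional_apply (ω : A →L[ℂ] ℂ) (u x : A) :
    conjFunctional ω u x = ω (star u * x * u) := by
  simp [conjFunctional, mul_assoc]

theorem conjFunctional_star_mul_self_nonneg {ω : A →L[ℂ] ℂ} (hω : ∀ a, 0 ≤ ω (star a * a))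
    (u a : A) : 0 ≤ conjFunctional ω u (star a * a) := by
  simpa [conjFunctional_apply, mul_assoc] using hω (a * u)

theorem conjFunctional_mem_stateSpace {ω : A →L[ℂ] ℂ} (hω : ω ∈ stateSpace A) {u : A}
    (hu : u ∈ unitary A) : conjFunctional ω u ∈ stateSpace A :=
  ⟨conjFunctional_star_mul_self_nonneg hω.1 u, by
    rw [conjFunctional_apply, mul_one, Unitary.star_mul_self_of_mem hu, hω.2]⟩

theorem conjFunctional_one_add_eq_smul {ω : A →L[ℂ] ℂ} (hω : ω ∈ pureStates A) {v : A}
    (hv : conjFunctional ω v = ω) :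
    conjFunctional ω (1 + v) = conjFunctional ω (1 + v) 1 • ω := by
  have hadd : conjFunctional ω (1 + v) + conjFunctional ω (1 - v) = (4 : ℂ) • ω := by
    ext x
    have hvx : ω (star v * x * v) = ω x := by rw [← conjFunctional_apply, hv]
    simp only [add_apply, smul_apply, smul_eq_mul, conjFunctional_apply, star_add, star_sub,
      star_one, mul_add, mul_sub, add_mul, sub_mul, one_mul, mul_one, map_add, map_sub, hvx]
    ring
  exact eq_apply_one_smul_of_add_eq_smul hω (conjFunctional_star_mul_self_nonneg hω.1.1 _)
    (conjFunctional_star_mul_self_nonneg hω.1.1 _) hadd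

/-- In the GNS representation of a pure state `ω`, the vector of `v` is proportional to the cyclic
vector as soon as it induces `ω`. -/
theorem apply_star_mul_of_conjFunctional_eq {ω : A →L[ℂ] ℂ} (hω : ω ∈ pureStates A) {v : A}
    (hv : conjFunctional ω v = ω) (x : A) : ω (star v * x) = ω (star v) * ω x := by
  have hsum : ∀ {w : A}, conjFunctional ω w = ω →
      ω (x * w) + ω (star w * x) = (ω w + ω (star w)) * ω x := fun {w} hw => by
    have hx : ω (star w * x * w) = ω x := by rw [← conjFunctional_apply, hw]
    have h1 : ω (star w * w) = 1 := by
      simpa [conjFunctional_apply, hω.1.2] using congrArg (fun θ => θ 1) hw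
    have h := congrArg (fun θ => θ x) (conjFunctional_one_add_eq_smul hω hw)
    simp only [smul_apply, smul_eq_mul, conjFunctional_apply, star_add, star_one, mul_add, add_mul,
      one_mul, mul_one, map_add, hω.1.2, hx, h1] at h
    linear_combination h
  have hI : conjFunctional ω (Complex.I • v) = ω := by
    conv_rhs => rw [← hv]
    ext y
    simp [conjFunctional_apply, smul_smul]
  have h1 := hsum hv
  have h2 := hsum hI
  simp only [star_smul, mul_smul_comm, smul_mul_assoc, map_smul, smul_eq_mul, Complex.star_def,
    Complex.conj_I] at h2
  linear_combination (h1 + Complex.I * h2 + (ω v * ω x - ω (x * v) + ω (star v * x)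
    - ω (star v) * ω x) * Complex.I_mul_I) / 2

/-- The vector functional `x ↦ ⟨v, π(x) v⟩` of a representation `π`. -/
def vectorFunctional {E : Type*} [NormedAddCommGroup E] [InnerProductSpace ℂ E] [CompleteSpace E]
    (π : A →⋆ₐ[ℂ] (E →L[ℂ] E)) (v : E) : A →L[ℂ] ℂ where
  toFun x := ⟪v, π x v⟫_ℂ
  map_add' x y := by simp
  map_smul' r x := by simp
  cont := continuous_const.inner (π.continuous_of_cstar.clm_apply continuous_const)

section VectorFunctional

variable {E : Type*} [NormedAddCommGroup E] [InnerProductSpace ℂ E] [CompleteSpace E]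
  (π : A →⋆ₐ[ℂ] (E →L[ℂ] E)) {v : E}

theorem vectorFunctional_star_mul_self (v : E) (x : A) :
    vectorFunctional π v (star x * x) = ((‖π x v‖ ^ 2 : ℝ) : ℂ) := by
  change ⟪v, π (star x * x) v⟫_ℂ = _
  rw [map_mul, map_star, mul_apply_eq_comp, ContinuousLinearMap.star_eq_adjoint,
    ContinuousLinearMap.adjoint_inner_right, inner_self_eq_norm_sq_to_K]
  simp

theorem vectorFunctional_mem_stateSpace (hv : ‖v‖ = 1) : vectorFunctional π v ∈ stateSpace A := by
  refine ⟨fun x => ?_, ?_⟩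
  · rw [vectorFunctional_star_mul_self]
    exact_mod_cast sq_nonneg ‖π x v‖
  · simpa [hv] using vectorFunctional_star_mul_self π v 1

end VectorFunctional

end States

/-! ### Flows and charged intertwiners -/

section Flows

variable {A : Type*} [CStarAlgebra A]

namespace AutFlow

section

variable (ρ : AutFlow A)

/-- The automorphism at time `t` as a continuous linear map. -/
def autL (t : ℝ) : A →L[ℂ] A where
  toLinearMap := (ρ.aut t : A →⋆ₐ[ℂ] A).toAlgHom.toLinearMap
  cont := (ρ.aut t : A →⋆ₐ[ℂ] A).continuous_of_cstar

theorem norm_aut_le (t : ℝ) (x : A) : ‖ρ.aut t x‖ ≤ ‖x‖ :=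
  NonUnitalStarAlgHom.norm_apply_le (ρ.aut t : A →⋆ₐ[ℂ] A) x

theorem aut_aut_neg (t : ℝ) (x : A) : ρ.aut t (ρ.aut (-t) x) = x := by
  rw [← ρ.aut_add, add_neg_cancel, ρ.aut_zero]

theorem comp_autL_mem_stateSpace {ω : A →L[ℂ] ℂ} (hω : ω ∈ stateSpace A) (t : ℝ) :
    ω.comp (ρ.autL t) ∈ stateSpace A := by
  refine ⟨fun x => ?_, ?_⟩
  · change 0 ≤ ω (ρ.aut t (star x * x))
    rw [map_mul, map_star]
    exact hω.1 _
  · change ω (ρ.aut t 1) = 1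
    rw [map_one, hω.2]

end

variable {ρ : AutFlow A} {x y d e : A}

/-- Since `ρ` is a group of isometries, the left difference quotients are obtained from the right
ones by applying `ρ`. -/
theorem hasGenerator_iff_hasDerivAt :
    ρ.HasGenerator x d ↔ HasDerivAt (fun t => ρ.aut t x) d 0 := by
  have hright : Tendsto (slope (fun t => ρ.aut t x) 0) (𝓝[>] 0) (𝓝 d) ↔ ρ.HasGenerator x d := by
    simp only [HasGenerator, slope_fun_def, sub_zero, vsub_eq_sub, ρ.aut_zero]
  rw [hasDerivAt_iff_tendsto_slope_left_right, hright, iff_and_self]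
  intro h
  have hneg : Tendsto (fun t : ℝ => -t) (𝓝[<] 0) (𝓝[>] 0) := by
    simpa using tendsto_neg_nhdsLT (a := (0 : ℝ))
  have hd : Tendsto (fun t => ρ.aut t d) (𝓝[<] 0) (𝓝 d) := by
    simpa [ρ.aut_zero] using ((ρ.continuous_aut d).tendsto 0).mono_left nhdsWithin_le_nhds
  have hsub : Tendsto (fun t => ρ.aut t ((-t)⁻¹ • (ρ.aut (-t) x - x) - d)) (𝓝[<] 0) (𝓝 0) :=
    squeeze_zero_norm (fun t => ρ.norm_aut_le t _)
      (tendsto_iff_norm_sub_tendsto_zero.mp (h.comp hneg))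
  refine (add_zero d ▸ hd.add hsub).congr fun t => ?_
  simp only [← map_add, add_sub_cancel, slope_def_module, sub_zero, ρ.aut_zero]
  rw [← Complex.coe_smul, map_smul, map_sub, ρ.aut_aut_neg, inv_neg, Complex.ofReal_neg, neg_smul,
    ← smul_neg, neg_sub, Complex.coe_smul]

theorem HasGenerator.mem_domain (h : ρ.HasGenerator x d) : x ∈ ρ.domain := ⟨d, h⟩

theorem hasGenerator_generator (hx : x ∈ ρ.domain) : ρ.HasGenerator x (ρ.generator x) := by
  rw [generator, dif_pos hx]
  exact hx.choose_spec

theorem HasGenerator.generator_eq (h : ρ.HasGenerator x d) : ρ.generator x = d :=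
  tendsto_nhds_unique (hasGenerator_generator h.mem_domain) h

variable (ρ) in
theorem hasGenerator_one : ρ.HasGenerator 1 0 := by
  simp [HasGenerator]

theorem HasGenerator.mul (hx : ρ.HasGenerator x d) (hy : ρ.HasGenerator y e) :
    ρ.HasGenerator (x * y) (d * y + x * e) := by
  rw [hasGenerator_iff_hasDerivAt] at *
  have h := HasDerivAt.mul hx hy
  rw [ρ.aut_zero, ρ.aut_zero] at h
  refine h.congr_of_eventuallyEq (Eventually.of_forall fun t => ?_)
  simp

theorem HasGenerator.star (hx : ρ.HasGenerator x d) : ρ.HasGenerator (star x) (star d) := by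
  rw [hasGenerator_iff_hasDerivAt] at *
  simpa only [map_star] using HasDerivAt.star hx

theorem HasGenerator.hasDerivAt (hx : ρ.HasGenerator x d) (t : ℝ) :
    HasDerivAt (fun s => ρ.aut s x) (ρ.aut t d) t := by
  have h0 : HasDerivAt (fun s => ρ.aut s x) d (t - t) := by
    rwa [sub_self, ← hasGenerator_iff_hasDerivAt]
  refine (((ρ.autL t).restrictScalars ℝ).hasFDerivAt.comp_hasDerivAt t
    (h0.comp_sub_const t t)).congr_of_eventuallyEq (Eventually.of_forall fun s => ?_)
  change ρ.aut s x = ρ.aut t (ρ.aut (s - t) x)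
  rw [← ρ.aut_add, add_sub_cancel]

theorem HasGenerator.of_tendsto {x d : ℕ → A} {x₀ d₀ : A} (h : ∀ n, ρ.HasGenerator (x n) (d n))
    (hx : Tendsto x atTop (𝓝 x₀)) (hd : Tendsto d atTop (𝓝 d₀)) : ρ.HasGenerator x₀ d₀ := by
  have huniform : TendstoUniformly (fun n t => ρ.aut t (d n)) (fun t => ρ.aut t d₀) atTop := by
    rw [Metric.tendstoUniformly_iff]
    intro ε hε
    filter_upwards [Metric.tendsto_nhds.mp hd ε hε] with n hn t
    rw [dist_comm, dist_eq_norm, ← map_sub]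
    exact (ρ.norm_aut_le t _).trans_lt (by rwa [← dist_eq_norm])
  have key := hasDerivAt_of_tendstoUniformly (f := fun n t => ρ.aut t (x n))
    (g := fun t => ρ.aut t x₀) huniform
    (Eventually.of_forall fun n t => (h n).hasDerivAt t)
    (fun t => ((ρ.autL t).continuous.tendsto x₀).comp hx) 0
  rwa [ρ.aut_zero, ← hasGenerator_iff_hasDerivAt] at key

theorem Invariant.apply_eq_zero {ω : A →L[ℂ] ℂ} (hω : ρ.Invariant ω) (hx : ρ.HasGenerator x d) :
    ω d = 0 := by
  have h := (ω.continuous.tendsto d).comp hx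
  refine tendsto_nhds_unique h ?_
  simp [Function.comp_def, ω.map_smul_of_tower, hω _ x]

theorem mem_intertwiners_iff {ω₁ ω₂ : A →L[ℂ] ℂ} {u : A} :
    u ∈ ρ.intertwiners ω₁ ω₂ ↔ u ∈ unitary A ∧ u ∈ ρ.domain ∧ conjFunctional ω₁ u = ω₂ := by
  simp [intertwiners, ContinuousLinearMap.ext_iff, conjFunctional_apply, eq_comm]

variable (ρ) in
/-- The intertwiners `u` from `ω₁` to `ω₂` of charge `i ω₁(u* δ(u)) = k`. -/
def chargedIntertwiners (ω₁ ω₂ : A →L[ℂ] ℂ) (k : ℂ) : Set A :=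
  {u ∈ ρ.intertwiners ω₁ ω₂ | Complex.I * ω₁ (star u * ρ.generator u) = k}

section ChargedIntertwiners

variable {ω₁ ω₂ ω₃ : A →L[ℂ] ℂ} {u w : A} {k l : ℂ}

theorem HasGenerator.mem_chargedIntertwiners (hd : ρ.HasGenerator u d) (hu : u ∈ unitary A)
    (hω : conjFunctional ω₁ u = ω₂) (hk : Complex.I * ω₁ (Star.star u * d) = k) :
    u ∈ ρ.chargedIntertwiners ω₁ ω₂ k :=
  ⟨mem_intertwiners_iff.mpr ⟨hu, hd.mem_domain, hω⟩, by rwa [hd.generator_eq]⟩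

variable (ρ ω₁) in
theorem one_mem_chargedIntertwiners : 1 ∈ ρ.chargedIntertwiners ω₁ ω₁ 0 :=
  (hasGenerator_one ρ).mem_chargedIntertwiners (one_mem _)
    (by ext x; simp [conjFunctional_apply]) (by simp)

theorem mul_mem_chargedIntertwiners (hw : w ∈ ρ.chargedIntertwiners ω₂ ω₃ l)
    (hu : u ∈ ρ.chargedIntertwiners ω₁ ω₂ k) : w * u ∈ ρ.chargedIntertwiners ω₁ ω₃ (k + l) := by
  obtain ⟨⟨huU, hud, hω₂⟩, hk⟩ := hu
  obtain ⟨⟨hwU, hwd, hω₃⟩, hl⟩ := hw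
  refine ((hasGenerator_generator hwd).mul (hasGenerator_generator hud)).mem_chargedIntertwiners
    (mul_mem hwU huU) ?_ ?_
  · ext x
    simp only [conjFunctional_apply, hω₃, hω₂, star_mul, mul_assoc]
  · rw [hω₂] at hl
    have hassoc : star (w * u) * (ρ.generator w * u + w * ρ.generator u) =
        star u * (star w * ρ.generator w) * u + star u * (star w * w) * ρ.generator u := by
      rw [star_mul]
      noncomm_ring
    rw [hassoc, Unitary.star_mul_self_of_mem hwU, mul_one, map_add]
    linear_combination hk + hl

theorem star_mul_mul_mul_star_mul_cancel (hu : u ∈ unitary A) (x : A) :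
    star u * (u * x * star u) * u = x := by
  calc star u * (u * x * star u) * u
    _ = star u * u * x * (star u * u) := by noncomm_ring
    _ = x := by rw [Unitary.star_mul_self_of_mem hu, one_mul, mul_one]

theorem star_mem_chargedIntertwiners (hu : u ∈ ρ.chargedIntertwiners ω₁ ω₂ k) :
    star u ∈ ρ.chargedIntertwiners ω₂ ω₁ (-k) := by
  obtain ⟨⟨huU, hud, hω₂⟩, hk⟩ := hu
  have hd := hasGenerator_generator hud
  have hcancel : star (ρ.generator u) * u + star u * ρ.generator u = 0 := by
    have h := hd.star.mul hd
    rw [Unitary.star_mul_self_of_mem huU] at h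
    rw [← h.generator_eq, (hasGenerator_one ρ).generator_eq]
  refine hd.star.mem_chargedIntertwiners (Unitary.star_mem huU) ?_ ?_
  · ext x
    rw [conjFunctional_apply, star_star, hω₂, star_mul_mul_mul_star_mul_cancel huU]
  · have hsplit : star u * (star (star u) * star (ρ.generator u)) * u =
        star u * u * (star (ρ.generator u) * u) := by
      rw [star_star]
      noncomm_ring
    rw [hω₂, hsplit, Unitary.star_mul_self_of_mem huU, one_mul, eq_neg_of_add_eq_zero_left hcancel,
      map_neg, mul_neg, hk]

/-- Two intertwiners differ by a unitary `v` with `ω₁ = ω₁ ∘ Ad v`, which multiplies the cyclic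
vector of the pure state `ω₁` by a phase and therefore does not contribute to the charge. -/
theorem charge_eq_of_mem_intertwiners (hω₁ : ω₁ ∈ pureStates A) (hinv : ρ.Invariant ω₁)
    (hu : u ∈ ρ.intertwiners ω₁ ω₂) (hw : w ∈ ρ.intertwiners ω₁ ω₂) :
    ω₁ (star w * ρ.generator w) = ω₁ (star u * ρ.generator u) := by
  obtain ⟨huU, hud, hωu⟩ := hu
  obtain ⟨-, hwd, hωw⟩ := hw
  have hdu := hasGenerator_generator hud
  have hdw := hasGenerator_generator hwd
  have huu := Unitary.star_mul_self_of_mem huU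
  have huu' := Unitary.mul_star_self_of_mem huU
  set v := star u * w with hv
  have hwuv : w = u * v := by rw [hv, ← mul_assoc, huu', one_mul]
  have hconj : conjFunctional ω₁ v = ω₁ := by
    ext x
    rw [conjFunctional_apply, hv, star_mul, star_star,
      show star w * u * x * (star u * w) = star w * (u * x * star u) * w by noncomm_ring,
      ← hωw, hωu, star_mul_mul_mul_star_mul_cancel huU]
  obtain ⟨c, hc⟩ : ∃ c, ρ.HasGenerator v c := ⟨_, hdu.star.mul hdw⟩
  have hgen : ρ.generator w = ρ.generator u * v + u * c := by
    rw [← (hdu.mul hc).generator_eq, ← hwuv]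
  have hsplit : star w * ρ.generator w =
      star v * (star u * ρ.generator u) * v + star v * (star u * u) * c := by
    rw [hgen, hwuv, star_mul]
    noncomm_ring
  rw [hsplit, huu, mul_one, map_add, ← conjFunctional_apply, hconj,
    apply_star_mul_of_conjFunctional_eq hω₁ hconj, hinv.apply_eq_zero hc, mul_zero, add_zero]

theorem index_eq_charge (hω₁ : ω₁ ∈ pureStates A) (hinv : ρ.Invariant ω₁)
    (hu : u ∈ ρ.intertwiners ω₁ ω₂) :
    ρ.index ω₁ ω₂ = Complex.I * ω₁ (star u * ρ.generator u) := by
  have hne : (ρ.intertwiners ω₁ ω₂).Nonempty := ⟨u, hu⟩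
  rw [index, dif_pos hne, charge_eq_of_mem_intertwiners hω₁ hinv hu hne.some_mem]

end ChargedIntertwiners

section InfiniteProducts

/-- The partial products `w (n - 1) * ⋯ * w 0`. -/
def leftProd {M : Type*} [Monoid M] (w : ℕ → M) : ℕ → M
  | 0 => 1
  | n + 1 => w n * leftProd w n

theorem leftProd_mem {M : Type*} [Monoid M] (S : Submonoid M) {w : ℕ → M} (hw : ∀ n, w n ∈ S) :
    ∀ n, leftProd w n ∈ S
  | 0 => one_mem S
  | n + 1 => mul_mem (hw n) (leftProd_mem S hw n)

variable {φ : ℕ → A →L[ℂ] ℂ} {w : ℕ → A}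

theorem cauchySeq_leftProd (hw : ∀ n, w n ∈ unitary A) (hsum : Summable fun n => ‖w n - 1‖) :
    CauchySeq (leftProd w) := by
  refine cauchySeq_of_dist_le_of_summable _ (fun n => ?_) hsum
  rw [dist_comm, dist_eq_norm, leftProd, ← sub_one_mul,
    CStarRing.norm_mul_mem_unitary _ (leftProd_mem _ hw n)]

theorem leftProd_mem_domain (hd : ∀ n, w n ∈ ρ.domain) : ∀ n, leftProd w n ∈ ρ.domain
  | 0 => (hasGenerator_one ρ).mem_domain
  | n + 1 => ((hasGenerator_generator (hd n)).mul
      (hasGenerator_generator (leftProd_mem_domain hd n))).mem_domain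

theorem generator_leftProd_succ (hd : ∀ n, w n ∈ ρ.domain) (n : ℕ) :
    ρ.generator (leftProd w (n + 1)) =
      ρ.generator (w n) * leftProd w n + w n * ρ.generator (leftProd w n) :=
  ((hasGenerator_generator (hd n)).mul
    (hasGenerator_generator (leftProd_mem_domain hd n))).generator_eq

theorem norm_generator_leftProd_le (hw : ∀ n, w n ∈ unitary A) (hd : ∀ n, w n ∈ ρ.domain) (n : ℕ) :
    ‖ρ.generator (leftProd w n)‖ ≤ ∑ i ∈ Finset.range n, ‖ρ.generator (w i)‖ := by
  induction n with
  | zero => simp [leftProd, (hasGenerator_one ρ).generator_eq]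
  | succ n ih =>
    rw [generator_leftProd_succ hd, Finset.sum_range_succ, add_comm]
    refine (norm_add_le _ _).trans (add_le_add ?_ ?_)
    · rwa [CStarRing.norm_mem_unitary_mul _ (hw n)]
    · rw [CStarRing.norm_mul_mem_unitary _ (leftProd_mem _ hw n)]

theorem cauchySeq_generator_leftProd (hw : ∀ n, w n ∈ unitary A) (hd : ∀ n, w n ∈ ρ.domain)
    (hsum : Summable fun n => ‖w n - 1‖) (hsum' : Summable fun n => ‖ρ.generator (w n)‖) :
    CauchySeq fun n => ρ.generator (leftProd w n) := by
  set C := ∑' n, ‖ρ.generator (w n)‖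
  have hC : ∀ n, ‖ρ.generator (leftProd w n)‖ ≤ C := fun n =>
    (norm_generator_leftProd_le hw hd n).trans (hsum'.sum_le_tsum _ fun _ _ => norm_nonneg _)
  refine cauchySeq_of_dist_le_of_summable _ (fun n => ?_) (hsum'.add (hsum.mul_right C))
  rw [dist_comm, dist_eq_norm, generator_leftProd_succ hd, add_sub_assoc, ← sub_one_mul]
  refine (norm_add_le _ _).trans (add_le_add ?_ ((norm_mul_le _ _).trans ?_))
  · rw [CStarRing.norm_mul_mem_unitary _ (leftProd_mem _ hw n)]
  · gcongr
    exact hC n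

theorem leftProd_mem_chargedIntertwiners
    (hw : ∀ n, w n ∈ ρ.chargedIntertwiners (φ n) (φ (n + 1)) 0) (n : ℕ) :
    leftProd w n ∈ ρ.chargedIntertwiners (φ 0) (φ n) 0 := by
  induction n with
  | zero => exact one_mem_chargedIntertwiners ρ (φ 0)
  | succ n ih => exact add_zero (0 : ℂ) ▸ mul_mem_chargedIntertwiners (hw n) ih

theorem exists_tendsto_of_summable
    (hw : ∀ n, w n ∈ ρ.chargedIntertwiners (φ n) (φ (n + 1)) 0)
    (hsum : Summable fun n => ‖w n - 1‖) (hsum' : Summable fun n => ‖ρ.generator (w n)‖) :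
    ∃ ψ, (ρ.chargedIntertwiners (φ 0) ψ 0).Nonempty ∧
      ∀ x, Tendsto (fun n => φ n x) atTop (𝓝 (ψ x)) := by
  have hwU : ∀ n, w n ∈ unitary A := fun n => (hw n).1.1
  have hwd : ∀ n, w n ∈ ρ.domain := fun n => (hw n).1.2.1
  have hprod := leftProd_mem_chargedIntertwiners hw
  obtain ⟨u, hu⟩ := cauchySeq_tendsto_of_complete (cauchySeq_leftProd hwU hsum)
  obtain ⟨d, hd⟩ := cauchySeq_tendsto_of_complete
    (cauchySeq_generator_leftProd hwU hwd hsum hsum')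
  have huU : u ∈ unitary A := isClosed_unitary.mem_of_tendsto hu
    (Eventually.of_forall fun n => (hprod n).1.1)
  have hud : ρ.HasGenerator u d :=
    HasGenerator.of_tendsto (fun n => hasGenerator_generator (hprod n).1.2.1) hu hd
  refine ⟨conjFunctional (φ 0) u, ⟨u, hud.mem_chargedIntertwiners huU rfl ?_⟩, fun x => ?_⟩
  · refine tendsto_nhds_unique
      (((φ 0).continuous.tendsto _).comp (hu.star.mul hd) |>.const_mul _) ?_
    simp only [Function.comp_def, (hprod _).2]
    exact tendsto_const_nhds
  · rw [conjFunctional_apply]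
    refine (((φ 0).continuous.tendsto _).comp ((hu.star.mul_const x).mul hu)).congr fun n => ?_
    exact ((hprod n).1.2.2 x).symm

end InfiniteProducts

end AutFlow

end Flows

/-! ### Normal ordering and Wick's theorem -/

section StarProjections

variable {H : Type*} [NormedAddCommGroup H] [InnerProductSpace ℂ H] [CompleteSpace H]
  {Q : H →L[ℂ] H}

theorem isStarProjection_apply_apply (hQ : IsStarProjection Q) (x : H) : Q (Q x) = Q x :=
  DFunLike.congr_fun hQ.isIdempotentElem x

theorem isStarProjection_apply_sub (hQ : IsStarProjection Q) (x : H) : Q (x - Q x) = 0 := by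
  rw [map_sub, isStarProjection_apply_apply hQ, sub_self]

theorem isStarProjection_inner_left (hQ : IsStarProjection Q) (x y : H) :
    ⟪Q x, y⟫_ℂ = ⟪x, Q y⟫_ℂ :=
  hQ.isSelfAdjoint.isSymmetric x y

end StarProjections

section NormalOrdering

namespace CAR

variable {H : Type u} [NormedAddCommGroup H] [InnerProductSpace ℂ H]

theorem a_smul (z : ℂ) (f : H) : a (z • f) = star z • a f :=
  ext_eval fun c => by simp [eval_a]

theorem a_sub (f g : H) : a (f - g) = a f - a g :=
  ext_eval fun c => by simp [eval_a]

theorem a_mul_a (f g : H) : a f * a g = -(a g * a f) :=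
  eq_neg_of_add_eq_zero_left (anticomm f g)

theorem a_mul_star_a (f g : H) : a f * star (a g) = ⟪f, g⟫_ℂ • 1 - star (a g) * a f :=
  eq_sub_of_add_eq (anticomm_star f g)

theorem star_a_mul_star_a (f g : H) : star (a f) * star (a g) = -(star (a g) * star (a f)) := by
  simpa using congrArg star (a_mul_a g f)

theorem closure_induction {p : CAR H → Prop} (hcl : IsClosed {x | p x}) (ha : ∀ f, p (a f))
    (hstar : ∀ f, p (star (a f))) (hr : ∀ r : ℂ, p (algebraMap ℂ _ r))
    (hadd : ∀ x y, p x → p y → p (x + y)) (hmul : ∀ x y, p x → p y → p (x * y)) (x : CAR H) :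
    p x := by
  have hmem : ∀ y (hy : y ∈ StarAlgebra.adjoin ℂ (Set.range (CARProduct.a (H := H)))),
      p (⟨y, StarSubalgebra.le_topologicalClosure _ hy⟩ : carSubalgebra H) := by
    intro y hy
    refine Algebra.adjoin_induction
      (p := fun y hy => p (⟨y, StarSubalgebra.le_topologicalClosure _ hy⟩ : carSubalgebra H))
      ?_ (fun r => hr r) (fun x y _ _ => hadd _ _) (fun x y _ _ => hmul _ _) hy
    rintro y (⟨f, rfl⟩ | ⟨f, hf⟩)
    · exact ha f
    · obtain rfl : y = star (CARProduct.a f) := by rw [hf, star_star]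
      exact hstar f
  refine hcl.closure_subset (Metric.mem_closure_iff.mpr fun ε hε => ?_)
  obtain ⟨w, hw, hxw⟩ := Metric.mem_closure_iff.mp x.2 ε hε
  exact ⟨_, hmem w hw, hxw⟩

/-- The product `a(f₁)* ⋯ a(fₘ)*`. -/
def creators {m : ℕ} (f : Fin m → H) : CAR H := (List.ofFn fun i => star (a (f i))).prod

/-- The product `a(gₙ) ⋯ a(g₁)`. -/
def annihilators {n : ℕ} (g : Fin n → H) : CAR H := (List.ofFn fun i => a (g i)).reverse.prod

theorem creators_zero (f : Fin 0 → H) : creators f = 1 := by simp [creators]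

theorem annihilators_zero (g : Fin 0 → H) : annihilators g = 1 := by simp [annihilators]

theorem creators_succ {m : ℕ} (f : Fin (m + 1) → H) :
    creators f = star (a (f 0)) * creators (fun i => f i.succ) := by
  simp [creators, List.ofFn_succ]

theorem annihilators_succ {n : ℕ} (g : Fin (n + 1) → H) :
    annihilators g = annihilators (fun i => g i.succ) * a (g 0) := by
  simp [annihilators, List.ofFn_succ]

theorem annihilators_snoc {n : ℕ} (g : Fin n → H) (h : H) :
    annihilators (Fin.snoc g h : Fin (n + 1) → H) = a h * annihilators g := by
  rw [annihilators, List.ofFn_succ_last]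
  simp [annihilators]

theorem annihilators_mul_a {n : ℕ} (g : Fin n → H) (h : H) :
    annihilators g * a h = (-1 : ℂ) ^ n • (a h * annihilators g) := by
  induction n with
  | zero => simp [annihilators_zero]
  | succ n ih =>
    rw [annihilators_succ, mul_assoc, a_mul_a, mul_neg, ← mul_assoc, ih, smul_mul_assoc, pow_succ,
      mul_assoc]
    simp

theorem star_a_mul_creators {m : ℕ} (f : Fin m → H) (h : H) :
    star (a h) * creators f = (-1 : ℂ) ^ m • (creators f * star (a h)) := by
  induction m with
  | zero => simp [creators_zero]
  | succ m ih =>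
    rw [creators_succ, ← mul_assoc, star_a_mul_star_a, neg_mul, mul_assoc, ih, mul_smul_comm,
      pow_succ, ← mul_assoc]
    simp

theorem a_mul_creators {k : ℕ} (f : Fin (k + 1) → H) (g : H) :
    a g * creators f = ∑ j : Fin (k + 1), ((-1 : ℂ) ^ (j : ℕ) * ⟪g, f j⟫_ℂ) •
        creators (fun i => f (j.succAbove i)) + (-1 : ℂ) ^ (k + 1) • (creators f * a g) := by
  induction k with
  | zero =>
    simp [creators_succ, creators_zero, a_mul_star_a, sub_eq_add_neg]
  | succ k ih =>
    have h := ih fun i => f i.succ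
    rw [Fin.sum_univ_succ, creators_succ, ← mul_assoc, a_mul_star_a, sub_mul, mul_assoc, h]
    simp only [Fin.succAbove_zero, Fin.val_zero, pow_zero, one_mul, smul_mul_assoc, mul_add,
      mul_smul_comm, Finset.mul_sum, Fin.val_succ]
    have : ∀ j : Fin (k + 1), creators (fun i => f (j.succ.succAbove i)) =
        star (a (f 0)) * creators (fun i => f (j.succAbove i).succ) := fun j => by
      rw [creators_succ]
      simp
    simp only [this, pow_succ, mul_assoc]
    simp only [mul_neg, neg_mul, neg_smul, mul_one, one_mul, Finset.sum_neg_distrib]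
    abel

variable (H) in
/-- The linear span of the normally ordered monomials. -/
def normalOrdered : Submodule ℂ (CAR H) :=
  Submodule.span ℂ {x | ∃ (m n : ℕ) (f : Fin m → H) (g : Fin n → H),
    x = creators f * annihilators g}

theorem creators_mul_annihilators_mem_normalOrdered {m n : ℕ} (f : Fin m → H) (g : Fin n → H) :
    creators f * annihilators g ∈ normalOrdered H :=
  Submodule.subset_span ⟨m, n, f, g, rfl⟩

theorem a_mul_mem_normalOrdered (h : H) {x : CAR H} (hx : x ∈ normalOrdered H) :
    a h * x ∈ normalOrdered H := by
  induction hx using Submodule.span_induction with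
  | mem x hx =>
    obtain ⟨m, n, f, g, rfl⟩ := hx
    cases m with
    | zero =>
      rw [creators_zero, one_mul, ← annihilators_snoc, ← one_mul (annihilators _),
        ← creators_zero f]
      exact creators_mul_annihilators_mem_normalOrdered _ _
    | succ m =>
      rw [← mul_assoc, a_mul_creators, add_mul, Finset.sum_mul, smul_mul_assoc, mul_assoc,
        ← annihilators_snoc]
      refine add_mem (sum_mem fun j _ => ?_) (Submodule.smul_mem _ _ ?_)
      · rw [smul_mul_assoc]
        exact Submodule.smul_mem _ _ (creators_mul_annihilators_mem_normalOrdered _ _)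
      · exact creators_mul_annihilators_mem_normalOrdered _ _
  | zero => simp
  | add x y _ _ hx hy => rw [mul_add]; exact add_mem hx hy
  | smul r x _ hx => rw [mul_smul_comm]; exact Submodule.smul_mem _ _ hx

theorem star_a_mul_mem_normalOrdered (h : H) {x : CAR H} (hx : x ∈ normalOrdered H) :
    star (a h) * x ∈ normalOrdered H := by
  induction hx using Submodule.span_induction with
  | mem x hx =>
    obtain ⟨m, n, f, g, rfl⟩ := hx
    have : star (a h) * (creators f * annihilators g) =
        creators (Fin.cons h f : Fin (m + 1) → H) * annihilators g := by
      rw [creators_succ, ← mul_assoc]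
      simp
    rw [this]
    exact creators_mul_annihilators_mem_normalOrdered _ _
  | zero => simp
  | add x y _ _ hx hy => rw [mul_add]; exact add_mem hx hy
  | smul r x _ hx => rw [mul_smul_comm]; exact Submodule.smul_mem _ _ hx

theorem mul_mem_closure_normalOrdered {c : CAR H}
    (hc : ∀ x ∈ normalOrdered H, c * x ∈ normalOrdered H) {x : CAR H}
    (hx : x ∈ (normalOrdered H).topologicalClosure) :
    c * x ∈ (normalOrdered H).topologicalClosure :=
  map_mem_closure (continuous_const_mul c) hx hc

theorem dense_normalOrdered : Dense (normalOrdered H : Set (CAR H)) := by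
  set N := (normalOrdered H).topologicalClosure
  have hN : IsClosed (N : Set (CAR H)) := Submodule.isClosed_topologicalClosure _
  have hmul : ∀ x, ∀ y ∈ N, x * y ∈ N := by
    refine closure_induction ?_ ?_ ?_ ?_ ?_ ?_
    · simp only [Set.ofPred_forall]
      exact isClosed_biInter fun y _ => hN.preimage (continuous_mul_const y)
    · exact fun f y => mul_mem_closure_normalOrdered fun _ => a_mul_mem_normalOrdered f
    · exact fun f y => mul_mem_closure_normalOrdered fun _ => star_a_mul_mem_normalOrdered f
    · intro r y hy
      rw [← Algebra.smul_def]
      exact N.smul_mem r hy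
    · intro x x' hx hx' y hy
      rw [add_mul]
      exact add_mem (hx y hy) (hx' y hy)
    · intro x x' hx hx' y hy
      rw [mul_assoc]
      exact hx _ (hx' y hy)
  have hone : (1 : CAR H) ∈ N := by
    refine Submodule.le_topologicalClosure _ ?_
    have h := creators_mul_annihilators_mem_normalOrdered (H := H) Fin.elim0 Fin.elim0
    rwa [creators_zero, annihilators_zero, one_mul] at h
  exact fun x => mul_one x ▸ hmul x 1 hone

theorem functional_ext {φ ψ : CAR H →L[ℂ] ℂ}
    (h : ∀ (m n : ℕ) (f : Fin m → H) (g : Fin n → H),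
      φ (creators f * annihilators g) = ψ (creators f * annihilators g)) : φ = ψ := by
  refine ContinuousLinearMap.ext_on (s := {x | ∃ (m n : ℕ) (f : Fin m → H) (g : Fin n → H),
    x = creators f * annihilators g}) dense_normalOrdered ?_
  rintro _ ⟨m, n, f, g, rfl⟩
  exact h m n f g

/-- The functional `φ` is a matrix element of the vacuum of the projection `P`, in which the range
of `P` is filled and its kernel is empty: it is killed by the `a g` and `star (a f)` that annihilate
this vacuum on the right, and by their adjoints on the left. It need not be a state. -/
structure IsVacuumFunctional (P : H →L[ℂ] H) (φ : CAR H →L[ℂ] ℂ) : Prop where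
  mul_a : ∀ x g, P g = 0 → φ (x * a g) = 0
  mul_star_a : ∀ x f, P f = f → φ (x * star (a f)) = 0
  a_mul : ∀ x f, P f = f → φ (a f * x) = 0
  star_a_mul : ∀ x g, P g = 0 → φ (star (a g) * x) = 0

namespace IsVacuumFunctional

variable [CompleteSpace H] {P : H →L[ℂ] H} {φ : CAR H →L[ℂ] ℂ}

theorem apply_mul_a (hφ : IsVacuumFunctional P φ) (hP : IsStarProjection P) (x : CAR H) (g : H) :
    φ (x * a g) = φ (x * a (P g)) := by
  have h := hφ.mul_a x _ (isStarProjection_apply_sub hP g)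
  rwa [a_sub, mul_sub, map_sub, sub_eq_zero] at h

theorem apply_star_a_mul (hφ : IsVacuumFunctional P φ) (hP : IsStarProjection P) (f : H)
    (x : CAR H) : φ (star (a f) * x) = φ (star (a (P f)) * x) := by
  have h := hφ.star_a_mul x _ (isStarProjection_apply_sub hP f)
  rwa [a_sub, star_sub, sub_mul, map_sub, sub_eq_zero] at h

/-- The annihilator of `g 0` is anticommuted to the far left, where it vanishes. -/
theorem apply_creators_mul_annihilators (hφ : IsVacuumFunctional P φ) (hP : IsStarProjection P)
    {k n : ℕ} (f : Fin (k + 1) → H) (g : Fin (n + 1) → H) :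
    φ (creators f * annihilators g) = (-1) ^ (n + k) * ∑ j : Fin (k + 1),
      (-1) ^ (j : ℕ) * ⟪g 0, P (f j)⟫_ℂ *
        φ (creators (fun i => f (j.succAbove i)) * annihilators (fun i => g i.succ)) := by
  set G := annihilators fun i => g i.succ with hG
  have hleft := hφ.a_mul (creators f * G) _ (isStarProjection_apply_apply hP (g 0))
  rw [← mul_assoc, a_mul_creators, add_mul, Finset.sum_mul, map_add, map_sum, smul_mul_assoc,
    map_smul, pow_succ] at hleft
  simp only [smul_mul_assoc, map_smul, smul_eq_mul, isStarProjection_inner_left hP] at hleft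
  have hsign : ((-1 : ℂ) ^ k) * (-1) ^ k = 1 := by rw [← mul_pow]; simp
  rw [annihilators_succ, ← hG, ← mul_assoc, hφ.apply_mul_a hP, mul_assoc, hG, annihilators_mul_a,
    ← hG, mul_smul_comm, map_smul, smul_eq_mul, ← mul_assoc, pow_add]
  linear_combination (-(-1) ^ n * (-1) ^ k) * hleft
    - (-1) ^ n * φ (creators f * a (P (g 0)) * G) * hsign

theorem apply_annihilators (hφ : IsVacuumFunctional P φ) (hP : IsStarProjection P) {n : ℕ}
    (g : Fin (n + 1) → H) : φ (annihilators g) = 0 := by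
  rw [annihilators_succ, hφ.apply_mul_a hP, annihilators_mul_a, map_smul,
    hφ.a_mul _ _ (isStarProjection_apply_apply hP _), smul_zero]

theorem apply_creators (hφ : IsVacuumFunctional P φ) (hP : IsStarProjection P) {m : ℕ}
    (f : Fin (m + 1) → H) : φ (creators f) = 0 := by
  rw [creators_succ, hφ.apply_star_a_mul hP, star_a_mul_creators, map_smul,
    hφ.mul_star_a _ _ (isStarProjection_apply_apply hP _), smul_zero]

theorem apply_of_ne (hφ : IsVacuumFunctional P φ) (hP : IsStarProjection P) {m n : ℕ}
    (f : Fin m → H) (g : Fin n → H) (hmn : m ≠ n) : φ (creators f * annihilators g) = 0 := by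
  induction n generalizing m with
  | zero =>
    obtain ⟨m, rfl⟩ := Nat.exists_eq_succ_of_ne_zero hmn
    rw [annihilators_zero, mul_one, hφ.apply_creators hP]
  | succ n ih =>
    cases m with
    | zero => rw [creators_zero, one_mul, hφ.apply_annihilators hP]
    | succ k =>
      rw [hφ.apply_creators_mul_annihilators hP, Finset.sum_eq_zero, mul_zero]
      intro j _
      rw [ih _ _ (by omega), mul_zero]

/-- Wick's theorem. -/
theorem apply_eq_det (hφ : IsVacuumFunctional P φ) (hP : IsStarProjection P) {n : ℕ}
    (f g : Fin n → H) : φ (creators f * annihilators g) =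
      φ 1 * (Matrix.of fun i j => ⟪g i, P (f j)⟫_ℂ).det := by
  induction n with
  | zero => simp [annihilators_zero, creators_zero]
  | succ n ih =>
    rw [hφ.apply_creators_mul_annihilators hP, Matrix.det_succ_row_zero, Finset.mul_sum,
      Finset.mul_sum, Even.neg_one_pow ⟨n, rfl⟩]
    refine Finset.sum_congr rfl fun j _ => ?_
    have hminor : (Matrix.of fun i j => ⟪g i, P (f j)⟫_ℂ).submatrix Fin.succ j.succAbove =
        Matrix.of fun i k => ⟪g i.succ, P (f (j.succAbove k))⟫_ℂ := rfl
    rw [ih, hminor, Matrix.of_apply]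
    ring

theorem isQuasiFree (hφ : IsVacuumFunctional P φ) (hP : IsStarProjection P) (h1 : φ 1 = 1) :
    IsQuasiFree P φ where
  eq_det n f g := by
    have h := hφ.apply_eq_det hP f g
    rwa [h1, one_mul] at h
  eq_zero m n f g hmn := hφ.apply_of_ne hP f g hmn

end IsVacuumFunctional

end CAR

theorem IsQuasiFree.unique {H : Type u} [NormedAddCommGroup H] [InnerProductSpace ℂ H]
    {P : H →L[ℂ] H} {ω ω' : CAR H →L[ℂ] ℂ} (h : IsQuasiFree P ω) (h' : IsQuasiFree P ω') :
    ω = ω' := by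
  refine CAR.functional_ext fun m n f g => ?_
  by_cases hmn : m = n
  · subst hmn
    exact (h.eq_det m f g).trans (h'.eq_det m f g).symm
  · exact (h.eq_zero m n f g hmn).trans (h'.eq_zero m n f g hmn).symm

end NormalOrdering

/-! ### Jordan–Wigner representations of the canonical anticommutation relations -/

section WeightedComp

variable {X : Type*}

theorem memℓp_weightedComp (σ : Equiv.Perm X) {m : X → ℂ} (hm : ∀ B, ‖m B‖ ≤ 1)
    (x : lp (fun _ : X => ℂ) 2) : Memℓp (fun B => m B * x (σ B)) 2 := by
  have h2 : (0 : ℝ) < (2 : ℝ≥0∞).toReal := by norm_num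
  rw [memℓp_gen_iff h2]
  have hx := (σ.summable_iff).mpr ((memℓp_gen_iff h2).mp (lp.memℓp x))
  refine Summable.of_nonneg_of_le (fun _ => by positivity) (fun B => ?_) hx
  simp only [Function.comp, norm_mul]
  gcongr
  exact mul_le_of_le_one_left (norm_nonneg _) (hm B)

/-- The operator `(T x)(B) = m(B) x(σ(B))` on `ℓ²(X)`. -/
def weightedComp (σ : Equiv.Perm X) (m : X → ℂ) (hm : ∀ B, ‖m B‖ ≤ 1) :
    lp (fun _ : X => ℂ) 2 →L[ℂ] lp (fun _ : X => ℂ) 2 :=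
  LinearMap.mkContinuous
    { toFun := fun x => ⟨fun B => m B * x (σ B), memℓp_weightedComp σ hm x⟩
      map_add' := fun x y => lp.ext (funext fun B => mul_add (m B) (x (σ B)) (y (σ B)))
      map_smul' := fun r x => lp.ext (funext fun B => by simp; ring) } 1 fun x => by
    have h2 : (0 : ℝ) < (2 : ℝ≥0∞).toReal := by norm_num
    rw [one_mul]
    refine lp.norm_le_of_tsum_le h2 (norm_nonneg _) ?_
    rw [lp.norm_rpow_eq_tsum h2 x, ← σ.tsum_eq fun B => ‖x B‖ ^ _]
    have hx := (memℓp_gen_iff h2).mp (lp.memℓp x)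
    refine Summable.tsum_le_tsum (fun B => ?_)
      ((memℓp_gen_iff h2).mp (memℓp_weightedComp σ hm x)) (σ.summable_iff.mpr hx)
    simp only [LinearMap.coe_mk, AddHom.coe_mk, norm_mul]
    gcongr
    exact mul_le_of_le_one_left (norm_nonneg _) (hm B)

theorem weightedComp_apply (σ : Equiv.Perm X) (m : X → ℂ) (hm : ∀ B, ‖m B‖ ≤ 1)
    (x : lp (fun _ : X => ℂ) 2) (B : X) : weightedComp σ m hm x B = m B * x (σ B) := rfl

theorem star_weightedComp (σ : Equiv.Perm X) (m m' : X → ℂ) (hm : ∀ B, ‖m B‖ ≤ 1)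
    (hm' : ∀ B, ‖m' B‖ ≤ 1) (hσ : ∀ B, σ (σ B) = B) (h : ∀ B, m' (σ B) = star (m B)) :
    star (weightedComp σ m hm) = weightedComp σ m' hm' := by
  rw [ContinuousLinearMap.star_eq_adjoint, eq_comm, ContinuousLinearMap.eq_adjoint_iff]
  intro x y
  rw [lp.inner_eq_tsum, lp.inner_eq_tsum, ← σ.tsum_eq]
  refine tsum_congr fun B => ?_
  simp only [weightedComp_apply, hσ, h, RCLike.inner_apply, map_mul, Complex.star_def,
    Complex.conj_conj]
  ring

end WeightedComp

section CARFamilies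

variable {ι A : Type*} [DecidableEq ι] [CStarAlgebra A]

/-- The canonical anticommutation relations for a family of annihilation operators, which plays the
role of the `a (e i)` for an orthonormal basis `e`. -/
structure IsCARFamily (c : ι → A) : Prop where
  anticomm : ∀ i j, c i * c j + c j * c i = 0
  anticomm_star : ∀ i j, c i * star (c j) + star (c j) * c i = if i = j then 1 else 0

namespace IsCARFamily

variable {c : ι → A}

theorem star_anticomm (hc : IsCARFamily c) (i j : ι) :
    star (c i) * c j + c j * star (c i) = if i = j then 1 else 0 := by
  rw [add_comm, hc.anticomm_star]
  simp only [eq_comm]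

theorem particle_hole (hc : IsCARFamily c) (p : ι → Prop) [DecidablePred p] :
    IsCARFamily fun i => if p i then star (c i) else c i where
  anticomm i j := by
    by_cases hi : p i <;> by_cases hj : p j <;> simp only [hi, hj, if_true, if_false]
    · simpa using congrArg star (hc.anticomm j i)
    · rw [hc.star_anticomm, if_neg fun h : i = j => hj (h ▸ hi)]
    · rw [hc.anticomm_star, if_neg fun h : i = j => hi (h ▸ hj)]
    · exact hc.anticomm i j
  anticomm_star i j := by
    by_cases hi : p i <;> by_cases hj : p j <;> simp only [hi, hj, if_true, if_false, star_star]
    · exact hc.star_anticomm i j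
    · rw [if_neg fun h : i = j => hj (h ▸ hi)]
      simpa using congrArg star (hc.anticomm j i)
    · rw [hc.anticomm, if_neg fun h : i = j => hi (h ▸ hj)]
    · exact hc.anticomm_star i j

theorem sum_smul_anticomm (hc : IsCARFamily c) (s : Finset ι) (α β : ι → ℂ) :
    (∑ i ∈ s, α i • c i) * (∑ i ∈ s, β i • c i) +
      (∑ i ∈ s, β i • c i) * (∑ i ∈ s, α i • c i) = 0 := by
  simp only [Finset.sum_mul_sum, smul_mul_smul_comm]
  rw [Finset.sum_comm (f := fun i j => (β i * α j) • (c i * c j)), ← Finset.sum_add_distrib]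
  refine Finset.sum_eq_zero fun i _ => ?_
  rw [← Finset.sum_add_distrib]
  refine Finset.sum_eq_zero fun j _ => ?_
  rw [mul_comm (β j), ← smul_add, hc.anticomm, smul_zero]

theorem sum_smul_anticomm_star (hc : IsCARFamily c) (s : Finset ι) (α β : ι → ℂ) :
    (∑ i ∈ s, α i • c i) * star (∑ i ∈ s, β i • c i) +
      star (∑ i ∈ s, β i • c i) * (∑ i ∈ s, α i • c i) =
        (∑ i ∈ s, α i * star (β i)) • (1 : A) := by
  simp only [star_sum, star_smul, Finset.sum_mul_sum, smul_mul_smul_comm]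
  rw [Finset.sum_comm (f := fun i j => (star (β i) * α j) • (star (c i) * c j)),
    ← Finset.sum_add_distrib, Finset.sum_smul]
  refine Finset.sum_congr rfl fun i hi => ?_
  rw [← Finset.sum_add_distrib]
  simp only [mul_comm (star (β _)), ← smul_add, hc.anticomm_star, smul_ite, smul_zero,
    Finset.sum_ite_eq, if_pos hi]

end IsCARFamily

end CARFamilies

section JordanWigner

variable {ι : Type*} [LinearOrder ι]

/-- Adding or removing the element `i`. -/
def toggle (i : ι) : Equiv.Perm (Finset ι) where
  toFun B := symmDiff B {i}
  invFun B := symmDiff B {i}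
  left_inv _ := symmDiff_symmDiff_cancel_right _ _
  right_inv _ := symmDiff_symmDiff_cancel_right _ _

theorem toggle_toggle (i : ι) (B : Finset ι) : toggle i (toggle i B) = B :=
  symmDiff_symmDiff_cancel_right _ _

theorem toggle_comm (i j : ι) (B : Finset ι) : toggle i (toggle j B) = toggle j (toggle i B) :=
  symmDiff_right_comm _ _ _

theorem mem_toggle (i j : ι) (B : Finset ι) :
    j ∈ toggle i B ↔ (if j = i then j ∉ B else j ∈ B) := by
  simp only [toggle, Equiv.coe_fn_mk, Finset.mem_symmDiff, Finset.mem_singleton]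
  split_ifs with h <;> simp [h]

/-- The sign `(-1) ^ #{j ∈ B | j < i}`. -/
def jwSign (i : ι) (B : Finset ι) : ℂ := (-1) ^ (B.filter (· < i)).card

theorem jwSign_mul_self (i : ι) (B : Finset ι) : jwSign i B * jwSign i B = 1 := by
  rw [jwSign, ← mul_pow]; simp

theorem norm_jwSign (i : ι) (B : Finset ι) : ‖jwSign i B‖ = 1 := by simp [jwSign]

theorem star_jwSign (i : ι) (B : Finset ι) : star (jwSign i B) = jwSign i B := by simp [jwSign]

theorem jwSign_toggle (i j : ι) (B : Finset ι) :
    jwSign j (toggle i B) = if i < j then -jwSign j B else jwSign j B := by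
  have key : ∀ B : Finset ι, i ∉ B →
      jwSign j (toggle i B) = if i < j then -jwSign j B else jwSign j B := by
    intro B hB
    have : toggle i B = insert i B := by
      ext k
      rw [mem_toggle]
      split_ifs with h <;> simp [h, hB]
    rw [this, jwSign, Finset.filter_insert]
    split_ifs with h
    · rw [Finset.card_insert_of_notMem (by simp [hB]), pow_succ, jwSign]
      ring
    · rfl
  by_cases hB : i ∈ B
  · have h := key (toggle i B) (by simp [mem_toggle, hB])
    rw [toggle_toggle] at h
    split_ifs at h ⊢ with hij
    · rw [h, neg_neg]
    · exact h.symm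
  · exact key B hB

/-- The Jordan-Wigner annihilation operators on `ℓ²(Finset ι)`. -/
def jwAnnihilator (i : ι) :
    lp (fun _ : Finset ι => ℂ) 2 →L[ℂ] lp (fun _ : Finset ι => ℂ) 2 :=
  weightedComp (toggle i) (fun B => if i ∈ B then 0 else jwSign i B) fun B => by
    split_ifs <;> simp [norm_jwSign]

/-- The Jordan-Wigner creation operators on `ℓ²(Finset ι)`. -/
def jwCreator (i : ι) :
    lp (fun _ : Finset ι => ℂ) 2 →L[ℂ] lp (fun _ : Finset ι => ℂ) 2 :=
  weightedComp (toggle i) (fun B => if i ∈ B then jwSign i B else 0) fun B => by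
    split_ifs <;> simp [norm_jwSign]

theorem star_jwAnnihilator (i : ι) : star (jwAnnihilator i) = jwCreator i := by
  refine star_weightedComp _ _ _ _ _ (toggle_toggle i) fun B => ?_
  simp only [mem_toggle, jwSign_toggle]
  by_cases h : i ∈ B <;> simp [h, star_jwSign]

theorem jwAnnihilator_anticomm (i j : ι) :
    jwAnnihilator i * jwAnnihilator j + jwAnnihilator j * jwAnnihilator i = 0 := by
  ext x B
  simp only [jwAnnihilator, add_apply, mul_apply_eq_comp,
    lp.coeFn_add, Pi.add_apply, weightedComp_apply, mem_toggle, jwSign_toggle, toggle_comm i j,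
    zero_apply, lp.coeFn_zero, Pi.zero_apply]
  rcases lt_trichotomy i j with h | h | h
  · by_cases hi : i ∈ B <;> by_cases hj : j ∈ B <;>
      simp [h, h.not_gt, h.ne, h.ne', hi, hj]
    ring
  · subst h
    by_cases hi : i ∈ B <;> simp [hi]
  · by_cases hi : i ∈ B <;> by_cases hj : j ∈ B <;>
      simp [h, h.not_gt, h.ne, h.ne', hi, hj]
    ring

theorem jwAnnihilator_anticomm_star (i j : ι) :
    jwAnnihilator i * star (jwAnnihilator j) + star (jwAnnihilator j) * jwAnnihilator i =
      if i = j then 1 else 0 := by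
  rw [star_jwAnnihilator]
  ext x B
  simp only [jwAnnihilator, jwCreator, add_apply,
    mul_apply_eq_comp,
    lp.coeFn_add, Pi.add_apply, weightedComp_apply, mem_toggle, jwSign_toggle, toggle_comm i j]
  rcases lt_trichotomy i j with h | h | h
  · by_cases hi : i ∈ B <;> by_cases hj : j ∈ B <;>
      simp [h, h.not_gt, h.ne, h.ne', hi, hj]
    ring
  · subst h
    by_cases hi : i ∈ B <;> simp [hi, toggle_toggle, ← mul_assoc, jwSign_mul_self]
  · by_cases hi : i ∈ B <;> by_cases hj : j ∈ B <;>
      simp [h, h.not_gt, h.ne, h.ne', hi, hj]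
    ring

theorem jwAnnihilator_vacuum (i : ι) : jwAnnihilator i (lp.single 2 ∅ 1) = 0 := by
  ext B
  simp only [jwAnnihilator, weightedComp_apply, lp.coeFn_zero, Pi.zero_apply]
  split_ifs with h
  · simp
  · rw [lp.single_apply_ne, mul_zero]
    intro h0
    have : i ∈ toggle i B := by simp [mem_toggle, h]
    simp [h0] at this

variable (ι) in
theorem isCARFamily_jwAnnihilator : IsCARFamily (jwAnnihilator (ι := ι)) :=
  ⟨jwAnnihilator_anticomm, jwAnnihilator_anticomm_star⟩

end JordanWigner

section OfBasis

theorem norm_sq_le_of_anticomm_star {A : Type*} [CStarAlgebra A] {x : A} {r : ℂ}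
    (hsq : x * x = 0) (h : x * star x + star x * x = r • 1) : ‖x‖ ^ 2 ≤ ‖r‖ := by
  have hx : star (star x * x) * (star x * x) = r • (star x * x) := by
    calc star (star x * x) * (star x * x)
        = star x * (x * star x + star x * x) * x - star x * star x * (x * x) := by
          simp only [star_mul, star_star]; noncomm_ring
      _ = r • (star x * x) := by
          rw [h, hsq]; simp
  have hn := congrArg norm hx
  rw [CStarRing.norm_star_mul_self, norm_smul, CStarRing.norm_star_mul_self] at hn
  rcases eq_or_ne ‖x‖ 0 with h0 | h0
  · simp [h0]
  · rw [sq, mul_right_cancel₀ (mul_ne_zero h0 h0) hn]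

variable {H : Type u} [NormedAddCommGroup H] [InnerProductSpace ℂ H]
  {ι : Type*} [DecidableEq ι] (e : HilbertBasis ι ℂ H)

namespace IsCARFamily

section

variable {A : Type*} [CStarAlgebra A] {c : ι → A}

theorem norm_sum_smul_sq_le (hc : IsCARFamily c) (s : Finset ι) (α : ι → ℂ) :
    ‖∑ i ∈ s, α i • c i‖ ^ 2 ≤ ∑ i ∈ s, ‖α i‖ ^ 2 := by
  have hsq : (∑ i ∈ s, α i • c i) * ∑ i ∈ s, α i • c i = 0 := by
    have h := hc.sum_smul_anticomm s α α
    rw [← two_smul ℂ] at h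
    exact (smul_eq_zero.mp h).resolve_left two_ne_zero
  refine (norm_sq_le_of_anticomm_star hsq (hc.sum_smul_anticomm_star s α α)).trans ?_
  exact (norm_sum_le _ _).trans_eq (Finset.sum_congr rfl fun i _ => by rw [norm_mul, norm_star, sq])

theorem summable_inner_smul (hc : IsCARFamily c) (f : H) :
    Summable fun i => ⟪f, e i⟫_ℂ • c i := by
  have hsum : Summable fun i => ‖⟪f, e i⟫_ℂ‖ ^ 2 := by
    refine (e.summable_inner_mul_inner f f).norm.congr fun i => ?_
    rw [norm_mul, norm_inner_symm (e i), sq]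
  rw [summable_iff_vanishing_norm] at hsum ⊢
  intro ε hε
  obtain ⟨s, hs⟩ := hsum (ε ^ 2) (by positivity)
  refine ⟨s, fun t ht => lt_of_pow_lt_pow_left₀ 2 hε.le ?_⟩
  exact (hc.norm_sum_smul_sq_le t _).trans_lt ((le_abs_self _).trans_lt (hs t ht))

end

variable {A : Type u} [CStarAlgebra A] [Nontrivial A] {c : ι → A}

/-- The CAR system with `a (e i) = c i`, where `e` is an orthonormal basis. -/
def toCARSystem (hc : IsCARFamily c) : CARSystem H where
  Alg := A
  a :=
    { toFun := fun f => ∑' i, ⟪f, e i⟫_ℂ • c i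
      map_add' := fun f g => by
        rw [← (hc.summable_inner_smul e f).tsum_add (hc.summable_inner_smul e g)]
        simp only [inner_add_left, add_smul]
      map_smul' := fun z f => by
        rw [← (hc.summable_inner_smul e f).tsum_const_smul]
        simp only [inner_smul_left, mul_smul] }
  anticomm f g := by
    have hf := (hc.summable_inner_smul e f).hasSum
    have hg := (hc.summable_inner_smul e g).hasSum
    refine tendsto_nhds_unique ((Tendsto.mul hf hg).add (Tendsto.mul hg hf)) ?_
    exact tendsto_const_nhds.congr fun s => (hc.sum_smul_anticomm s _ _).symm
  anticomm_star f g := by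
    have hf := (hc.summable_inner_smul e f).hasSum
    have hg := (hc.summable_inner_smul e g).hasSum
    refine tendsto_nhds_unique ((Tendsto.mul hf hg.star).add (Tendsto.mul hg.star hf)) ?_
    refine (Tendsto.smul_const (e.hasSum_inner_mul_inner f g) (1 : A)).congr fun s => ?_
    rw [← star_sum, hc.sum_smul_anticomm_star]
    simp only [Complex.star_def, inner_conj_symm]

/-- The representation of `CAR H` with `a (e i) ↦ c i`. -/
def representation (hc : IsCARFamily c) : CAR H →⋆ₐ[ℂ] A :=
  CAR.eval (hc.toCARSystem e)

theorem hasSum_representation_a (hc : IsCARFamily c) (f : H) :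
    HasSum (fun i => ⟪f, e i⟫_ℂ • c i) (hc.representation e (CAR.a f)) := by
  have h : hc.representation e (CAR.a f) = (hc.toCARSystem e).a f := CAR.eval_a _ f
  rw [h]
  exact (hc.summable_inner_smul e f).hasSum

end IsCARFamily

end OfBasis

/-! ### Existence, purity and invariance of quasi-free states -/

section Existence

theorem exists_hilbertBasis_mem_or_mem_orthogonal {𝕜 E : Type*} [RCLike 𝕜] [NormedAddCommGroup E]
    [InnerProductSpace 𝕜 E] [CompleteSpace E] (K : Submodule 𝕜 E) [CompleteSpace K] :
    ∃ (w : Set E) (b : HilbertBasis w 𝕜 E), ∀ i, b i ∈ K ∨ b i ∈ Kᗮ := by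
  obtain ⟨w₀, b₀, -⟩ := exists_hilbertBasis 𝕜 K
  have hs : Orthonormal 𝕜 ((↑) : Set.range (fun i => (b₀ i : E)) → E) :=
    (b₀.orthonormal.comp_linearIsometry K.subtypeₗᵢ).toSubtypeRange
  obtain ⟨w, b, hw, hb⟩ := hs.exists_hilbertBasis_extension
  refine ⟨w, b, fun i => or_iff_not_imp_left.mpr fun hi => ?_⟩
  rw [← Submodule.orthogonalProjectionOnto_eq_zero_iff, ← b₀.repr.map_eq_zero_iff]
  ext j
  have hne : (⟨b₀ j, hw ⟨j, rfl⟩⟩ : w) ≠ i := by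
    rintro rfl
    exact hi (by simp [hb])
  have hij := b.orthonormal.2 hne
  rw [hb] at hij
  simpa [b₀.repr_apply_apply, Submodule.coe_inner, hb] using hij

variable {H : Type u} [NormedAddCommGroup H] [InnerProductSpace ℂ H]

namespace CAR

theorem isVacuumFunctional_of_mem_stateSpace {P : H →L[ℂ] H} {ω : CAR H →L[ℂ] ℂ}
    (hω : ω ∈ stateSpace (CAR H)) (ha : ∀ g, P g = 0 → ω (star (a g) * a g) = 0)
    (hstar : ∀ f, P f = f → ω (a f * star (a f)) = 0) : IsVacuumFunctional P ω := by
  have ha' g (hg : P g = 0) :=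
    apply_mul_eq_zero_of_apply_star_mul_self_eq_zero hω.1 (ha g hg)
  have hstar' f (hf : P f = f) := apply_mul_eq_zero_of_apply_star_mul_self_eq_zero hω.1
    (x := star (a f)) (by rw [star_star, hstar f hf])
  exact ⟨fun x g hg => (ha' g hg x).1, fun x f hf => (hstar' f hf x).1,
    fun x f hf => by simpa using (hstar' f hf x).2, fun x g hg => (ha' g hg x).2⟩

variable [CompleteSpace H] {P : H →L[ℂ] H} {ι : Type u}

section FockRepresentation

variable [DecidableEq ι] {E : Type u} [NormedAddCommGroup E] [InnerProductSpace ℂ E]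
  [CompleteSpace E] [Nontrivial E] {c : ι → E →L[ℂ] E}

theorem representation_a_apply_eq_zero (hP : IsStarProjection P) (e : HilbertBasis ι ℂ H)
    (hc : IsCARFamily c) {Ω : E} (hΩ : ∀ i, P (e i) ≠ e i → c i Ω = 0) {g : H} (hg : P g = 0) :
    hc.representation e (a g) Ω = 0 := by
  refine ((hc.hasSum_representation_a e g).mapL
    (ContinuousLinearMap.apply ℂ _ Ω)).unique (hasSum_zero.congr_fun fun i => ?_)
  by_cases hi : P (e i) = e i
  · have hgi : ⟪g, e i⟫_ℂ = 0 := by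
      rw [← hi, ← isStarProjection_inner_left hP, hg, inner_zero_left]
    simp [hgi]
  · simp [hΩ i hi]

theorem representation_star_a_apply_eq_zero (hP : IsStarProjection P) (e : HilbertBasis ι ℂ H)
    (hc : IsCARFamily c) {Ω : E} (hΩ : ∀ i, P (e i) ≠ 0 → star (c i) Ω = 0) {f : H}
    (hf : P f = f) : hc.representation e (star (a f)) Ω = 0 := by
  rw [map_star]
  refine ((hc.hasSum_representation_a e f).star.mapL
    (ContinuousLinearMap.apply ℂ _ Ω)).unique (hasSum_zero.congr_fun fun i => ?_)
  by_cases hi : P (e i) = 0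
  · have hfi : ⟪f, e i⟫_ℂ = 0 := by
      rw [← hf, isStarProjection_inner_left hP, hi, inner_zero_right]
    simp [hfi]
  · simp [hΩ i hi]

end FockRepresentation

theorem exists_isVacuumFunctional_of_basis [LinearOrder ι] (hP : IsStarProjection P)
    (e : HilbertBasis ι ℂ H) (he : ∀ i, P (e i) = e i ∨ P (e i) = 0) :
    ∃ ω ∈ stateSpace (CAR H), IsVacuumFunctional P ω := by
  classical
  have hc := (isCARFamily_jwAnnihilator ι).particle_hole fun i => P (e i) = e i
  let Ω : lp (fun _ : Finset ι => ℂ) 2 := lp.single 2 ∅ 1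
  have hΩ : ‖Ω‖ = 1 := by simp [Ω, lp.norm_single]
  have : Nontrivial (lp (fun _ : Finset ι => ℂ) 2) :=
    ⟨Ω, 0, fun h => by simp [h] at hΩ⟩
  let π := hc.representation e
  have hω := vectorFunctional_mem_stateSpace π hΩ
  refine ⟨_, hω, isVacuumFunctional_of_mem_stateSpace hω (fun g hg => ?_) fun f hf => ?_⟩
  · have hzero := representation_a_apply_eq_zero hP e hc (Ω := Ω)
      (fun i hi => by simp [hi, Ω, jwAnnihilator_vacuum]) hg
    rw [vectorFunctional_star_mul_self, hzero]
    simp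
  · have hzero := representation_star_a_apply_eq_zero hP e hc (Ω := Ω)
      (fun i hi => by simp [(he i).resolve_right hi, Ω, jwAnnihilator_vacuum]) hf
    have hnorm := vectorFunctional_star_mul_self π Ω (star (a f))
    rw [star_star, hzero] at hnorm
    simpa using hnorm

theorem exists_isVacuumFunctional (hP : IsStarProjection P) :
    ∃ ω ∈ stateSpace (CAR H), IsVacuumFunctional P ω := by
  have : CompleteSpace P.ker := P.isClosed_ker.completeSpace_coe
  obtain ⟨ι, e, he⟩ := exists_hilbertBasis_mem_or_mem_orthogonal P.ker
  classical
  let : LinearOrder ι := linearOrderOfSTO WellOrderingRel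
  refine exists_isVacuumFunctional_of_basis hP e fun i => (he i).symm.imp (fun hi => ?_) id
  refine (sub_eq_zero.mp (inner_self_eq_zero (𝕜 := ℂ).mp ?_)).symm
  have hker := isStarProjection_apply_sub hP (e i)
  rw [inner_sub_right, hi _ hker, ← isStarProjection_inner_left hP, hker, inner_zero_left,
    sub_zero]

end CAR

variable [CompleteSpace H] {P : H →L[ℂ] H} {ω : CAR H →L[ℂ] ℂ}

theorem existsUnique_isQuasiFree (hP : IsStarProjection P) :
    ∃! ω : CAR H →L[ℂ] ℂ, IsQuasiFree P ω := by
  obtain ⟨ω, hω, h⟩ := CAR.exists_isVacuumFunctional hP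
  exact ⟨ω, h.isQuasiFree hP hω.2, fun ω' h' => h'.unique (h.isQuasiFree hP hω.2)⟩

namespace IsQuasiFree

theorem mem_stateSpace (h : IsQuasiFree P ω) (hP : IsStarProjection P) :
    ω ∈ stateSpace (CAR H) := by
  obtain ⟨ω', hω, h'⟩ := CAR.exists_isVacuumFunctional hP
  rwa [h.unique (h'.isQuasiFree hP hω.2)]

theorem isVacuumFunctional (h : IsQuasiFree P ω) (hP : IsStarProjection P) :
    CAR.IsVacuumFunctional P ω := by
  obtain ⟨ω', hω, h'⟩ := CAR.exists_isVacuumFunctional hP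
  rwa [h.unique (h'.isQuasiFree hP hω.2)]

theorem of_twoPoint (hP : IsStarProjection P) (hω : ω ∈ stateSpace (CAR H))
    (h : ∀ f, ω (star (CAR.a f) * CAR.a f) = ⟪f, P f⟫_ℂ) : IsQuasiFree P ω := by
  refine (CAR.isVacuumFunctional_of_mem_stateSpace hω (fun g hg => ?_) fun f hf => ?_).isQuasiFree
    hP hω.2
  · rw [h, hg, inner_zero_right]
  · rw [CAR.a_mul_star_a, map_sub, map_smul, hω.2, h, hf]
    simp

/-- A component of a convex decomposition of `ω` vanishes wherever `ω` does on positive elements,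
so it satisfies the same vacuum conditions. -/
theorem mem_pureStates (h : IsQuasiFree P ω) (hP : IsStarProjection P) :
    ω ∈ pureStates (CAR H) := by
  refine ⟨h.mem_stateSpace hP, ?_⟩
  rintro ω₁ h₁ ω₂ h₂ ⟨s, t, hs, ht, -, rfl⟩
  have hv := h.isVacuumFunctional hP
  have key (x : CAR H) (hx : (s • ω₁ + t • ω₂) (star x * x) = 0) : ω₁ (star x * x) = 0 := by
    have p₁ : 0 ≤ s • ω₁ (star x * x) := smul_nonneg hs.le (h₁.1 x)
    have p₂ : 0 ≤ t • ω₂ (star x * x) := smul_nonneg ht.le (h₂.1 x)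
    exact (smul_eq_zero.mp ((add_eq_zero_iff_of_nonneg p₁ p₂).mp hx).1).resolve_left hs.ne'
  have hv₁ := CAR.isVacuumFunctional_of_mem_stateSpace (P := P) h₁
    (fun g hg => key _ (hv.mul_a _ _ hg))
    fun f hf => by simpa using key (star (CAR.a f)) (hv.mul_star_a _ _ hf)
  exact (hv₁.isQuasiFree hP h₁.2).unique h

theorem apply_star_a_mul_a {H : Type u} [NormedAddCommGroup H] [InnerProductSpace ℂ H]
    {P : H →L[ℂ] H} {ω : CAR H →L[ℂ] ℂ} (h : IsQuasiFree P ω) (f g : H) :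
    ω (star (CAR.a f) * CAR.a g) = ⟪g, P f⟫_ℂ := by
  simpa using h.eq_det 1 (fun _ => f) (fun _ => g)

theorem invariant (h : IsQuasiFree P ω) (hP : IsStarProjection P) :
    (CAR.charge H).Invariant ω := by
  intro t x
  have hqf : IsQuasiFree P (ω.comp ((CAR.charge H).autL t)) := by
    refine of_twoPoint hP (AutFlow.comp_autL_mem_stateSpace _ (h.mem_stateSpace hP) t) fun f => ?_
    change ω ((CAR.charge H).aut t (star (CAR.a f) * CAR.a f)) = _
    rw [map_mul, CAR.charge_a, CAR.charge_star_a, smul_mul_smul_comm, ← Complex.exp_add,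
      add_neg_cancel, Complex.exp_zero, one_smul, h.apply_star_a_mul_a]
  exact DFunLike.congr_fun (hqf.unique h) x

end IsQuasiFree

end Existence

/-! ### Intertwiners built from field operators -/

section FieldOperators

namespace CAR

variable {H : Type u} [NormedAddCommGroup H] [InnerProductSpace ℂ H] {e p q : H}

/-- The field operator `a(f) + a(f)*`. -/
def field (f : H) : CAR H := a f + star (a f)

theorem star_field (f : H) : star (field f) = field f := by
  rw [field, star_add, star_star, add_comm]

theorem field_sub (f g : H) : field (f - g) = field f - field g := by
  simp only [field, a_sub, star_sub]
  abel

theorem field_anticomm (f g : H) :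
    field f * field g + field g * field f = (⟪f, g⟫_ℂ + ⟪g, f⟫_ℂ) • 1 := by
  have hsplit : field f * field g + field g * field f = (a f * a g + a g * a f) +
      (a f * star (a g) + star (a g) * a f) + (a g * star (a f) + star (a f) * a g) +
      (star (a f) * star (a g) + star (a g) * star (a f)) := by
    simp only [field]
    noncomm_ring
  rw [hsplit, anticomm, anticomm_star, anticomm_star, star_a_mul_star_a g f, add_neg_cancel,
    zero_add, add_zero, add_smul]

theorem field_mul_self (f : H) : field f * field f = (‖f‖ ^ 2 : ℂ) • 1 := by
  have h := field_anticomm f f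
  rw [← two_smul ℂ, ← two_mul, mul_smul, inner_self_eq_norm_sq_to_K] at h
  exact smul_right_injective _ (two_ne_zero : (2 : ℂ) ≠ 0) h

theorem field_mul_self_of_norm_eq_one (he : ‖e‖ = 1) : field e * field e = 1 := by
  simp [field_mul_self, he]

theorem field_mem_unitary (he : ‖e‖ = 1) : field e ∈ unitary (CAR H) := by
  rw [Unitary.mem_iff, star_field, field_mul_self_of_norm_eq_one he]
  exact ⟨rfl, rfl⟩

theorem norm_field_le (f : H) : ‖field f‖ ≤ ‖f‖ := by
  nontriviality CAR H
  refine le_of_sq_le_sq (le_of_eq ?_) (norm_nonneg f)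
  rw [sq, ← CStarRing.norm_star_mul_self, star_field, field_mul_self, norm_smul, norm_one, mul_one]
  simp

theorem hasGenerator_field (f : H) :
    (charge H).HasGenerator (field f) (field (Complex.I • f)) := by
  have hmul : HasDerivAt (fun t : ℝ => Complex.I * t) Complex.I 0 := by
    simpa using (Complex.ofRealCLM.hasDerivAt (x := (0 : ℝ))).const_mul Complex.I
  have hcreate : HasDerivAt (fun t : ℝ => Complex.exp (Complex.I * t)) Complex.I 0 := by
    simpa using hmul.cexp
  have hannihilate : HasDerivAt (fun t : ℝ => Complex.exp (-(Complex.I * t))) (-Complex.I) 0 := by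
    simpa using hmul.neg.cexp
  have hfield : field (Complex.I • f) = -Complex.I • a f + Complex.I • star (a f) := by
    simp [field, a_smul]
  rw [AutFlow.hasGenerator_iff_hasDerivAt, hfield]
  refine ((hannihilate.smul_const (a f)).add
    (hcreate.smul_const (star (a f)))).congr_of_eventuallyEq (Eventually.of_forall fun t => ?_)
  simp [field, charge_a, charge_star_a]

theorem norm_field_mul_field_sub_one_le (hp : ‖p‖ = 1) :
    ‖field q * field p - 1‖ ≤ ‖p - q‖ := by
  rw [← field_mul_self_of_norm_eq_one hp, ← sub_mul, ← field_sub, norm_sub_rev p,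
    CStarRing.norm_mul_mem_unitary _ (field_mem_unitary hp)]
  exact norm_field_le _

theorem norm_generator_field_mul_field_le (hp : ‖p‖ = 1) :
    ‖(charge H).generator (field q * field p)‖ ≤ 2 * ‖p - q‖ := by
  have hI : ‖Complex.I • p‖ = 1 := by rw [norm_smul, hp, Complex.norm_I, one_mul]
  have hanticomm : field (Complex.I • p) * field p + field p * field (Complex.I • p) = 0 := by
    rw [field_anticomm, inner_smul_left, inner_smul_right, Complex.conj_I, neg_mul, neg_add_cancel,
      zero_smul]
  have hsplit : field (Complex.I • q) * field p + field q * field (Complex.I • p) =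
      field (Complex.I • (q - p)) * field p + field (q - p) * field (Complex.I • p) := by
    rw [smul_sub, field_sub, field_sub, sub_mul, sub_mul, sub_add_sub_comm, hanticomm, sub_zero]
  rw [((hasGenerator_field q).mul (hasGenerator_field p)).generator_eq, hsplit, two_mul,
    norm_sub_rev p]
  refine (norm_add_le _ _).trans (add_le_add ?_ ?_)
  · rw [CStarRing.norm_mul_mem_unitary _ (field_mem_unitary hp)]
    simpa [norm_smul] using norm_field_le (Complex.I • (q - p))
  · rw [CStarRing.norm_mul_mem_unitary _ (field_mem_unitary hI)]
    exact norm_field_le _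

theorem a_mul_field (e g : H) : a g * field e = ⟪g, e⟫_ℂ • 1 - field e * a g := by
  rw [← anticomm_star, field, add_mul, mul_add, a_mul_a e g]
  abel

theorem field_mul_star_a (e f : H) :
    field e * star (a f) = ⟪e, f⟫_ℂ • 1 - star (a f) * field e := by
  simpa [star_field] using congrArg star (a_mul_field e f)

theorem field_mul_star_a_mul_a_mul_field (he : ‖e‖ = 1) (f g : H) :
    field e * (star (a f) * a g) * field e = (⟪e, f⟫_ℂ * ⟪g, e⟫_ℂ) • 1 -
      ⟪e, f⟫_ℂ • (field e * a g) - ⟪g, e⟫_ℂ • (star (a f) * field e) + star (a f) * a g := by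
  have hassoc : field e * (star (a f) * a g) * field e =
      (field e * star (a f)) * (a g * field e) := by simp only [mul_assoc]
  have hcancel : star (a f) * field e * (field e * a g) = star (a f) * a g := by
    rw [mul_assoc, ← mul_assoc (field e), field_mul_self_of_norm_eq_one he, one_mul]
  rw [hassoc, a_mul_field, field_mul_star_a, sub_mul, mul_sub, mul_sub, hcancel]
  simp only [smul_mul_assoc, mul_smul_comm, one_mul, mul_one, smul_smul]
  rw [mul_comm ⟪g, e⟫_ℂ]
  abel

end CAR

namespace IsQuasiFree

variable {H : Type u} [NormedAddCommGroup H] [InnerProductSpace ℂ H]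
  {Q : H →L[ℂ] H} {ω : CAR H →L[ℂ] ℂ}

theorem apply_one (h : IsQuasiFree Q ω) : ω 1 = 1 := by
  simpa using h.eq_det 0 Fin.elim0 Fin.elim0

theorem apply_a_mul_a (h : IsQuasiFree Q ω) (f g : H) : ω (CAR.a f * CAR.a g) = 0 := by
  simpa using h.eq_zero 0 2 Fin.elim0 ![g, f] (by norm_num)

theorem apply_star_a_mul_star_a (h : IsQuasiFree Q ω) (f g : H) :
    ω (star (CAR.a f) * star (CAR.a g)) = 0 := by
  simpa using h.eq_zero 2 0 ![f, g] Fin.elim0 (by norm_num)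

theorem apply_field_mul_a (h : IsQuasiFree Q ω) (e f : H) :
    ω (CAR.field e * CAR.a f) = ⟪f, Q e⟫_ℂ := by
  rw [CAR.field, add_mul, map_add, h.apply_a_mul_a, h.apply_star_a_mul_a, zero_add]

theorem apply_star_a_mul_field (h : IsQuasiFree Q ω) (e f : H) :
    ω (star (CAR.a f) * CAR.field e) = ⟪e, Q f⟫_ℂ := by
  rw [CAR.field, mul_add, map_add, h.apply_star_a_mul_star_a, h.apply_star_a_mul_a, add_zero]

theorem apply_field_mul_field (h : IsQuasiFree Q ω) (e f : H) :
    ω (CAR.field e * CAR.field f) = ⟪f, Q e⟫_ℂ + (⟪e, f⟫_ℂ - ⟪e, Q f⟫_ℂ) := by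
  rw [CAR.field.eq_1 f, mul_add, map_add, h.apply_field_mul_a, CAR.field_mul_star_a, map_sub,
    map_smul, h.apply_one, h.apply_star_a_mul_field, smul_eq_mul, mul_one]

end IsQuasiFree

end FieldOperators

open InnerProductSpace (rankOne rankOne_apply)

section PrincipalFamily

variable {H : Type u} [NormedAddCommGroup H] [InnerProductSpace ℂ H] {Q : H →L[ℂ] H}
  {ι κ : Type*} {s : Finset ι} {k : ι}

theorem sub_sum_rankOne_apply_eq_self {v : ι → H} (hv : Orthonormal ℂ v) (hk : k ∉ s)
    (hQv : Q (v k) = v k) : (Q - ∑ j ∈ s, rankOne ℂ (v j) (v j)) (v k) = v k := by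
  rw [sub_apply, hQv, sum_apply, Finset.sum_eq_zero, sub_zero]
  intro j hj
  rw [rankOne_apply, hv.2 (ne_of_mem_of_not_mem hj hk), zero_smul]

/-- Principal vectors for the range of `Q`: an orthonormal family `p` in the range and an
orthonormal family `q` such that `Q` maps each `q k` into the line spanned by `p k`. -/
structure IsPrincipalFamily (Q : H →L[ℂ] H) (p q : ι → H) : Prop where
  orthonormal_left : Orthonormal ℂ p
  orthonormal_right : Orthonormal ℂ q
  apply_left : ∀ k, Q (p k) = p k
  apply_right : ∀ k, Q (q k) = ⟪p k, q k⟫_ℂ • p k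

/-- The operator obtained from `Q` by replacing the directions `p k` by `q k` for `k ∈ s`. -/
def exchange (Q : H →L[ℂ] H) (p q : ι → H) (s : Finset ι) : H →L[ℂ] H :=
  Q + ∑ k ∈ s, (rankOne ℂ (q k) (q k) - rankOne ℂ (p k) (p k))

theorem exchange_empty (Q : H →L[ℂ] H) (p q : ι → H) : exchange Q p q ∅ = Q := by
  simp [exchange]

theorem exchange_insert [DecidableEq ι] (hk : k ∉ s) (Q : H →L[ℂ] H) (p q : ι → H) :
    exchange Q p q (insert k s) =
      exchange Q p q s + (rankOne ℂ (q k) (q k) - rankOne ℂ (p k) (p k)) := by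
  rw [exchange, exchange, Finset.sum_insert hk, add_left_comm, add_comm]

theorem exchange_apply (Q : H →L[ℂ] H) (p q : ι → H) (s : Finset ι) (x : H) :
    exchange Q p q s x = Q x + ∑ k ∈ s, (⟪q k, x⟫_ℂ • q k - ⟪p k, x⟫_ℂ • p k) := by
  simp [exchange]

theorem IsPrincipalFamily.comp {p q : ι → H} (hF : IsPrincipalFamily Q p q) {f : κ → ι}
    (hf : Function.Injective f) : IsPrincipalFamily Q (p ∘ f) (q ∘ f) where
  orthonormal_left := hF.orthonormal_left.comp f hf
  orthonormal_right := hF.orthonormal_right.comp f hf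
  apply_left i := hF.apply_left (f i)
  apply_right i := hF.apply_right (f i)

end PrincipalFamily

section Exchange

variable {H : Type u} [NormedAddCommGroup H] [InnerProductSpace ℂ H] [CompleteSpace H]
  {Q Q' : H →L[ℂ] H} {ω ω' : CAR H →L[ℂ] ℂ} {e p q : H}

theorem isStarProjection_sub_rankOne (hQ : IsStarProjection Q) (he : ‖e‖ = 1) (hQe : Q e = e) :
    IsStarProjection (Q - rankOne ℂ e e) := by
  refine (InnerProductSpace.isStarProjection_rankOne_self he).sub_of_mul_eq_right hQ ?_
  ext x
  simp [hQe]

theorem isStarProjection_add_rankOne (hQ : IsStarProjection Q) (he : ‖e‖ = 1) (hQe : Q e = 0) :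
    IsStarProjection (Q + rankOne ℂ e e) := by
  refine hQ.add (InnerProductSpace.isStarProjection_rankOne_self he) ?_
  ext x
  simp [hQe]

theorem isStarProjection_add_rankOne_sub_rankOne (hQ : IsStarProjection Q) (hp : ‖p‖ = 1)
    (hq : ‖q‖ = 1) (hQp : Q p = p) (hQq : Q q = ⟪p, q⟫_ℂ • p) :
    IsStarProjection (Q + (rankOne ℂ q q - rankOne ℂ p p)) := by
  rw [add_sub_left_comm, add_comm]
  exact isStarProjection_add_rankOne (isStarProjection_sub_rankOne hQ hp hQp) hq (by simp [hQq])

namespace IsQuasiFree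

theorem field_mem_chargedIntertwiners (h : IsQuasiFree Q ω) (hQ : IsStarProjection Q)
    (he : ‖e‖ = 1) (hQe : Q e = e) (h' : IsQuasiFree (Q - rankOne ℂ e e) ω') :
    CAR.field e ∈ (CAR.charge H).chargedIntertwiners ω ω' 1 := by
  have hconj : IsQuasiFree (Q - rankOne ℂ e e) (conjFunctional ω (CAR.field e)) := by
    refine of_twoPoint (isStarProjection_sub_rankOne hQ he hQe)
      (conjFunctional_mem_stateSpace (h.mem_stateSpace hQ) (CAR.field_mem_unitary he)) fun f => ?_
    rw [conjFunctional_apply, CAR.star_field, CAR.field_mul_star_a_mul_a_mul_field he]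
    simp only [map_add, map_sub, map_smul, h.apply_field_mul_a, h.apply_star_a_mul_field,
      h.apply_one, h.apply_star_a_mul_a, smul_eq_mul, mul_one, sub_apply, rankOne_apply,
      inner_sub_right, inner_smul_right, hQe, ← isStarProjection_inner_left hQ e]
    ring
  refine (CAR.hasGenerator_field e).mem_chargedIntertwiners (CAR.field_mem_unitary he)
    (hconj.unique h') ?_
  rw [CAR.star_field, h.apply_field_mul_field, map_smul, hQe, sub_self, add_zero, inner_smul_left,
    inner_self_eq_norm_sq_to_K, he]
  simp

theorem field_mul_field_mem_chargedIntertwiners (h : IsQuasiFree Q ω) (hQ : IsStarProjection Q)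
    (hp : ‖p‖ = 1) (hq : ‖q‖ = 1) (hQp : Q p = p) (hQq : Q q = ⟪p, q⟫_ℂ • p)
    (h' : IsQuasiFree (Q + (rankOne ℂ q q - rankOne ℂ p p)) ω') :
    CAR.field q * CAR.field p ∈ (CAR.charge H).chargedIntertwiners ω ω' 0 := by
  have hQ' := isStarProjection_add_rankOne_sub_rankOne hQ hp hq hQp hQq
  have hQ'q : (Q + (rankOne ℂ q q - rankOne ℂ p p)) q = q := by
    simp [hQq, inner_self_eq_norm_sq_to_K, hq]
  obtain ⟨ω₀, h₀, -⟩ := existsUnique_isQuasiFree (isStarProjection_sub_rankOne hQ hp hQp)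
  have hemptyq := h'.field_mem_chargedIntertwiners hQ' hq hQ'q (ω' := ω₀)
    (by rwa [add_sub_left_comm, add_sub_cancel_left])
  have hfillq := AutFlow.star_mem_chargedIntertwiners hemptyq
  rw [CAR.star_field] at hfillq
  simpa using AutFlow.mul_mem_chargedIntertwiners hfillq
    (h.field_mem_chargedIntertwiners hQ hp hQp h₀)

end IsQuasiFree

section Emptying

variable {ι : Type*} {v : ι → H}

theorem isStarProjection_sub_sum_rankOne (hQ : IsStarProjection Q) (hv : Orthonormal ℂ v)
    (hQv : ∀ i, Q (v i) = v i) (s : Finset ι) :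
    IsStarProjection (Q - ∑ i ∈ s, rankOne ℂ (v i) (v i)) := by
  classical
  induction s using Finset.induction_on with
  | empty => simpa using hQ
  | insert i s hi ih =>
    rw [Finset.sum_insert hi, add_comm, ← sub_sub]
    exact isStarProjection_sub_rankOne ih (hv.1 i) (sub_sum_rankOne_apply_eq_self hv hi (hQv i))

theorem IsQuasiFree.nonempty_chargedIntertwiners_sub_sum_rankOne (h : IsQuasiFree Q ω)
    (hQ : IsStarProjection Q) (hv : Orthonormal ℂ v) (hQv : ∀ i, Q (v i) = v i) (s : Finset ι)
    (h' : IsQuasiFree (Q - ∑ i ∈ s, rankOne ℂ (v i) (v i)) ω') :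
    ((CAR.charge H).chargedIntertwiners ω ω' s.card).Nonempty := by
  classical
  induction s using Finset.induction_on generalizing ω' with
  | empty =>
    obtain rfl : ω = ω' := h.unique (by simpa using h')
    exact ⟨1, by simpa using AutFlow.one_mem_chargedIntertwiners (CAR.charge H) ω⟩
  | insert i s hi ih =>
    have hs := isStarProjection_sub_sum_rankOne hQ hv hQv s
    obtain ⟨ω₀, h₀, -⟩ := existsUnique_isQuasiFree hs
    obtain ⟨u, hu⟩ := ih h₀
    rw [Finset.sum_insert hi, add_comm, ← sub_sub] at h'
    have hfield := h₀.field_mem_chargedIntertwiners hs (hv.1 i)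
      (sub_sum_rankOne_apply_eq_self hv hi (hQv i)) h'
    rw [Finset.card_insert_of_notMem hi, Nat.cast_succ]
    exact ⟨_, AutFlow.mul_mem_chargedIntertwiners hfield hu⟩

end Emptying

namespace IsPrincipalFamily

variable {ι : Type*} {p q : ι → H} {s : Finset ι} {k : ι}

theorem inner_left_right_eq_zero (hF : IsPrincipalFamily Q p q) (hQ : IsStarProjection Q) {l : ι}
    (hkl : k ≠ l) : ⟪p k, q l⟫_ℂ = 0 := by
  rw [← hF.apply_left, isStarProjection_inner_left hQ, hF.apply_right, inner_smul_right,
    hF.orthonormal_left.2 hkl, mul_zero]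

theorem exchange_apply_left (hF : IsPrincipalFamily Q p q) (hQ : IsStarProjection Q)
    (hk : k ∉ s) : exchange Q p q s (p k) = p k := by
  rw [exchange_apply, hF.apply_left, Finset.sum_eq_zero, add_zero]
  intro l hl
  have hlk := ne_of_mem_of_not_mem hl hk
  rw [inner_eq_zero_symm.mp (hF.inner_left_right_eq_zero hQ hlk.symm),
    hF.orthonormal_left.2 hlk, zero_smul, zero_smul, sub_zero]

theorem exchange_apply_right (hF : IsPrincipalFamily Q p q) (hQ : IsStarProjection Q)
    (hk : k ∉ s) : exchange Q p q s (q k) = ⟪p k, q k⟫_ℂ • p k := by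
  rw [exchange_apply, hF.apply_right, Finset.sum_eq_zero, add_zero]
  intro l hl
  have hlk := ne_of_mem_of_not_mem hl hk
  rw [hF.inner_left_right_eq_zero hQ hlk, hF.orthonormal_right.2 hlk, zero_smul, zero_smul,
    sub_zero]

theorem isStarProjection_exchange (hF : IsPrincipalFamily Q p q) (hQ : IsStarProjection Q)
    (s : Finset ι) : IsStarProjection (exchange Q p q s) := by
  classical
  induction s using Finset.induction_on with
  | empty => rwa [exchange_empty]
  | insert k s hk ih =>
    rw [exchange_insert hk]
    exact isStarProjection_add_rankOne_sub_rankOne ih (hF.orthonormal_left.1 k)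
      (hF.orthonormal_right.1 k) (hF.exchange_apply_left hQ hk) (hF.exchange_apply_right hQ hk)

theorem field_mul_field_mem_chargedIntertwiners [DecidableEq ι] (hF : IsPrincipalFamily Q p q)
    (hQ : IsStarProjection Q) (hk : k ∉ s) (h : IsQuasiFree (exchange Q p q s) ω)
    (h' : IsQuasiFree (exchange Q p q (insert k s)) ω') :
    CAR.field (q k) * CAR.field (p k) ∈ (CAR.charge H).chargedIntertwiners ω ω' 0 := by
  rw [exchange_insert hk] at h'
  exact h.field_mul_field_mem_chargedIntertwiners (hF.isStarProjection_exchange hQ s)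
    (hF.orthonormal_left.1 k) (hF.orthonormal_right.1 k) (hF.exchange_apply_left hQ hk)
    (hF.exchange_apply_right hQ hk) h'

theorem nonempty_chargedIntertwiners_exchange (hF : IsPrincipalFamily Q p q)
    (hQ : IsStarProjection Q) (h : IsQuasiFree Q ω) (h' : IsQuasiFree (exchange Q p q s) ω') :
    ((CAR.charge H).chargedIntertwiners ω ω' 0).Nonempty := by
  classical
  induction s using Finset.induction_on generalizing ω' with
  | empty =>
    obtain rfl : ω = ω' := h.unique (by rwa [exchange_empty] at h')
    exact ⟨1, AutFlow.one_mem_chargedIntertwiners (CAR.charge H) ω⟩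
  | insert k s hk ih =>
    obtain ⟨ω₀, h₀, -⟩ := existsUnique_isQuasiFree (hF.isStarProjection_exchange hQ s)
    obtain ⟨u, hu⟩ := ih h₀
    have hfields := hF.field_mul_field_mem_chargedIntertwiners hQ hk h₀ h'
    exact ⟨_, add_zero (0 : ℂ) ▸ AutFlow.mul_mem_chargedIntertwiners hfields hu⟩

theorem nonempty_chargedIntertwiners_of_nat {p q : ℕ → H} (hF : IsPrincipalFamily Q p q)
    (hQ : IsStarProjection Q) (hQ' : IsStarProjection Q') (hsum : Summable fun k => ‖p k - q k‖)
    (hQQ' : ∀ x, HasSum (fun k => ⟪q k, x⟫_ℂ • q k - ⟪p k, x⟫_ℂ • p k) (Q' x - Q x))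
    (h : IsQuasiFree Q ω) (h' : IsQuasiFree Q' ω') :
    ((CAR.charge H).chargedIntertwiners ω ω' 0).Nonempty := by
  have hproj (n : ℕ) := hF.isStarProjection_exchange hQ (Finset.range n)
  choose φ hφ _ using fun n => existsUnique_isQuasiFree (hproj n)
  obtain rfl : φ 0 = ω := (hφ 0).unique (by simpa [exchange_empty] using h)
  have hstep (n : ℕ) : CAR.field (q n) * CAR.field (p n) ∈
      (CAR.charge H).chargedIntertwiners (φ n) (φ (n + 1)) 0 :=
    hF.field_mul_field_mem_chargedIntertwiners hQ Finset.notMem_range_self (hφ n)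
      (Finset.range_add_one (n := n) ▸ hφ (n + 1))
  obtain ⟨ψ, hψ, hlim⟩ := AutFlow.exists_tendsto_of_summable hstep
    (.of_nonneg_of_le (fun _ => norm_nonneg _)
      (fun n => CAR.norm_field_mul_field_sub_one_le (hF.orthonormal_left.1 n)) hsum)
    (.of_nonneg_of_le (fun _ => norm_nonneg _)
      (fun n => CAR.norm_generator_field_mul_field_le (hF.orthonormal_left.1 n))
      (hsum.mul_left 2))
  have hlimQ (x : H) : Tendsto (fun n => exchange Q p q (Finset.range n) x) atTop (𝓝 (Q' x)) := by
    simpa only [exchange_apply, add_sub_cancel] using (hQQ' x).tendsto_sum_nat.const_add (Q x)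
  have hψ_state : ψ ∈ stateSpace (CAR H) := by
    obtain ⟨u, hu, -⟩ := hψ
    obtain ⟨huU, -, rfl⟩ := AutFlow.mem_intertwiners_iff.mp hu
    exact conjFunctional_mem_stateSpace ((hφ 0).mem_stateSpace (hproj 0)) huU
  obtain rfl : ψ = ω' := by
    refine (IsQuasiFree.of_twoPoint hQ' hψ_state fun f => ?_).unique h'
    refine tendsto_nhds_unique (hlim _) ?_
    simp only [(hφ _).apply_star_a_mul_a]
    exact tendsto_const_nhds.inner (hlimQ f)
  exact hψ

theorem nonempty_chargedIntertwiners (hF : IsPrincipalFamily Q p q) (hQ : IsStarProjection Q)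
    (hQ' : IsStarProjection Q') (hsum : Summable fun k => ‖p k - q k‖)
    (hQQ' : ∀ x, HasSum (fun k => ⟪q k, x⟫_ℂ • q k - ⟪p k, x⟫_ℂ • p k) (Q' x - Q x))
    (h : IsQuasiFree Q ω) (h' : IsQuasiFree Q' ω') :
    ((CAR.charge H).chargedIntertwiners ω ω' 0).Nonempty := by
  let S := Function.support fun k => ‖p k - q k‖
  have hsupp (x : H) : (Function.support fun k => ⟪q k, x⟫_ℂ • q k - ⟪p k, x⟫_ℂ • p k) ⊆ S := by
    refine Function.support_subset_iff'.mpr fun k hk => ?_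
    rw [sub_eq_zero.mp (norm_eq_zero.mp (Function.notMem_support.mp hk)), sub_self]
  have hQQ'S (x : H) := (hasSum_subtype_iff_of_support_subset (hsupp x)).mpr (hQQ' x)
  have : Countable S := hsum.countable_support
  rcases finite_or_infinite S with hfin | hinf
  · have := Fintype.ofFinite S
    refine (hF.comp Subtype.val_injective).nonempty_chargedIntertwiners_exchange hQ h
      (s := (Finset.univ : Finset S)) ?_
    convert h' using 1
    ext x
    rw [exchange_apply]
    exact (sub_eq_iff_eq_add'.mp ((hQQ'S x).unique (hasSum_fintype _))).symm
  · obtain ⟨e⟩ := nonempty_equiv_of_countable (α := ℕ) (β := S)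
    have hsum' := (hsum.subtype S).comp_injective e.injective
    exact (hF.comp (Subtype.val_injective.comp e.injective)).nonempty_chargedIntertwiners_of_nat
      hQ hQ' hsum' (fun x => e.hasSum_iff.mpr (hQQ'S x)) h h'

end IsPrincipalFamily

end Exchange

/-! ### Hilbert–Schmidt sums and trace class operators -/

section HilbertSchmidt

variable {𝕜 E F ι κ : Type*} [RCLike 𝕜] [NormedAddCommGroup E] [InnerProductSpace 𝕜 E]
  [NormedAddCommGroup F]

theorem hasSum_sq_norm_inner (e : HilbertBasis ι 𝕜 E) (x : E) :
    HasSum (fun i => ‖inner 𝕜 (e i) x‖ ^ 2) (‖x‖ ^ 2) := by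
  simpa [e.repr_apply_apply] using lp.hasSum_norm (by norm_num) (e.repr x)

theorem summable_sq_norm_apply_of_orthonormal [InnerProductSpace 𝕜 F] [CompleteSpace E]
    [CompleteSpace F] {A : E →L[𝕜] F} (e : HilbertBasis ι 𝕜 F)
    (he : Summable fun i => ‖A.adjoint (e i)‖ ^ 2) {p : κ → E} (hp : Orthonormal 𝕜 p) :
    Summable fun k => ‖A (p k)‖ ^ 2 := by
  refine summable_of_sum_le (c := ∑' i, ‖A.adjoint (e i)‖ ^ 2) (fun k => sq_nonneg _) fun s => ?_
  have hcoeff (k : κ) : HasSum (fun i => ‖inner 𝕜 (p k) (A.adjoint (e i))‖ ^ 2)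
      (‖A (p k)‖ ^ 2) := by
    simpa only [A.adjoint_inner_right, norm_inner_symm] using hasSum_sq_norm_inner e (A (p k))
  have hsum := hasSum_sum fun k (_ : k ∈ s) => hcoeff k
  rw [← hsum.tsum_eq]
  exact hsum.summable.tsum_le_tsum (fun i => hp.sum_inner_products_le _) he

variable [NormedSpace 𝕜 F]

theorem norm_sum_inner_smul_sq_le {e : ι → E} (he : Orthonormal 𝕜 e) (y : ι → F) (s : Finset ι)
    (x : E) : ‖∑ i ∈ s, inner 𝕜 (e i) x • y i‖ ^ 2 ≤ (∑ i ∈ s, ‖y i‖ ^ 2) * ‖x‖ ^ 2 :=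
  calc ‖∑ i ∈ s, inner 𝕜 (e i) x • y i‖ ^ 2
    _ ≤ (∑ i ∈ s, ‖inner 𝕜 (e i) x‖ * ‖y i‖) ^ 2 := by
      gcongr
      exact norm_sum_le_of_le s fun i _ => norm_smul_le _ _
    _ ≤ (∑ i ∈ s, ‖inner 𝕜 (e i) x‖ ^ 2) * ∑ i ∈ s, ‖y i‖ ^ 2 :=
      Finset.sum_mul_sq_le_sq_mul_sq s _ _
    _ ≤ (∑ i ∈ s, ‖y i‖ ^ 2) * ‖x‖ ^ 2 := by
      rw [mul_comm]
      gcongr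
      exact he.sum_inner_products_le x

theorem norm_sub_sum_smulRight_le {A : E →L[𝕜] F} (e : HilbertBasis ι 𝕜 E)
    (he : Summable fun i => ‖A (e i)‖ ^ 2) (s : Finset ι) :
    ‖A - ∑ i ∈ s, (innerSL 𝕜 (e i)).smulRight (A (e i))‖ ≤
      √(∑' i : {i // i ∉ s}, ‖A (e i)‖ ^ 2) := by
  refine ContinuousLinearMap.opNorm_le_bound _ (Real.sqrt_nonneg _) fun x => ?_
  have hA : HasSum (fun i : {i // i ∉ s} => inner 𝕜 (e i) x • A (e i))
      ((A - ∑ i ∈ s, (innerSL 𝕜 (e i)).smulRight (A (e i))) x) := by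
    refine (s.hasSum_compl_iff (f := fun i => inner 𝕜 (e i) x • A (e i))).mpr ?_
    simpa [sum_apply, e.repr_apply_apply] using (e.hasSum_repr x).mapL A
  refine le_of_tendsto hA.norm (.of_forall fun t => ?_)
  refine le_of_sq_le_sq ?_ (by positivity)
  rw [mul_pow, Real.sq_sqrt (tsum_nonneg fun _ => sq_nonneg _)]
  refine (norm_sum_inner_smul_sq_le (e.orthonormal.comp _ Subtype.val_injective) _ t x).trans ?_
  gcongr
  exact (he.subtype _).sum_le_tsum t fun _ _ => sq_nonneg _

theorem isCompactOperator_of_summable_sq_norm [CompleteSpace F] {A : E →L[𝕜] F}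
    (e : HilbertBasis ι 𝕜 E) (he : Summable fun i => ‖A (e i)‖ ^ 2) : IsCompactOperator A := by
  let S (s : Finset ι) : E →L[𝕜] F := ∑ i ∈ s, (innerSL 𝕜 (e i)).smulRight (A (e i))
  have hS (s : Finset ι) : IsCompactOperator (S s) := by
    refine sum_mem (S := compactOperator (RingHom.id 𝕜) E F) fun i _ => ?_
    have : IsCompactOperator (innerSL 𝕜 (e i)) := isCompactOperator_of_locallyCompactSpace_dom _
    exact this.clm_comp (ContinuousLinearMap.toSpanSingleton 𝕜 (A (e i)))
  have hlim : Tendsto S atTop (𝓝 A) := by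
    rw [tendsto_iff_norm_sub_tendsto_zero]
    refine squeeze_zero (fun s => norm_nonneg _)
      (fun s => norm_sub_rev A (S s) ▸ norm_sub_sum_smulRight_le e he s) ?_
    simpa using (tendsto_tsum_compl_atTop_zero fun i => ‖A (e i)‖ ^ 2).sqrt
  exact isCompactOperator_of_tendsto hlim (.of_forall hS)

end HilbertSchmidt

section TraceClass

variable {H : Type u} [NormedAddCommGroup H] [InnerProductSpace ℂ H] [CompleteSpace H]
  {T : H →L[ℂ] H}

theorem inner_mul_self_apply {B : H →L[ℂ] H} (hB : IsSelfAdjoint B) (x : H) :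
    ⟪x, (B * B) x⟫_ℂ = (‖B x‖ : ℂ) ^ 2 := by
  rw [mul_apply_eq_comp, ← hB.isSymmetric.apply_clm, inner_self_eq_norm_sq_to_K]
  rfl

theorem IsTraceClass.exists_isSelfAdjoint_mul_self_eq_abs (hT : IsTraceClass T) :
    ∃ B : H →L[ℂ] H, IsSelfAdjoint B ∧ B * B = CFC.abs T ∧
      ∃ (ι : Type u) (e : HilbertBasis ι ℂ H), Summable fun i => ‖B (e i)‖ ^ 2 := by
  obtain ⟨ι, e, he⟩ := hT
  have hB : IsSelfAdjoint (CFC.sqrt (CFC.abs T)) := .of_nonneg (CFC.sqrt_nonneg _)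
  have hBB : CFC.sqrt (CFC.abs T) * CFC.sqrt (CFC.abs T) = CFC.abs T :=
    CFC.sqrt_mul_sqrt_self _ (CFC.abs_nonneg T)
  refine ⟨_, hB, hBB, ι, e, he.congr fun i => ?_⟩
  rw [congrArg (· (e i)) hBB.symm, inner_mul_self_apply hB]
  simp

theorem IsTraceClass.isCompactOperator_star_mul_self (hT : IsTraceClass T) :
    IsCompactOperator (star T * T) := by
  obtain ⟨B, -, hBB, ι, e, he⟩ := hT.exists_isSelfAdjoint_mul_self_eq_abs
  rw [← CFC.abs_mul_abs, ← hBB]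
  exact (isCompactOperator_of_summable_sq_norm e he).clm_comp (B * B * B)

theorem IsTraceClass.summable_re_inner_abs (hT : IsTraceClass T) {κ : Type*} {p : κ → H}
    (hp : Orthonormal ℂ p) : Summable fun k => (⟪p k, CFC.abs T (p k)⟫_ℂ).re := by
  obtain ⟨B, hB, hBB, ι, e, he⟩ := hT.exists_isSelfAdjoint_mul_self_eq_abs
  have hsum := summable_sq_norm_apply_of_orthonormal (A := B) e (by rwa [hB.adjoint_eq]) hp
  refine hsum.congr fun k => ?_
  rw [← hBB, inner_mul_self_apply hB]
  norm_cast

theorem apply_eq_smul_of_apply_apply_eq_sq_smul {A : H →L[ℂ] H} (hA : 0 ≤ A) {s : ℝ} (hs : 0 ≤ s)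
    {x : H} (hx : A (A x) = (s : ℂ) ^ 2 • x) : A x = (s : ℂ) • x := by
  rcases hs.eq_or_lt with rfl | hs
  · have hnorm := inner_mul_self_apply (IsSelfAdjoint.of_nonneg hA) x
    rw [mul_apply_eq_comp, hx] at hnorm
    simpa using hnorm.symm
  · set y := A x - (s : ℂ) • x
    have hy : A y = -((s : ℂ) • y) := by
      rw [map_sub, map_smul, hx]
      module
    have hpos := ((ContinuousLinearMap.nonneg_iff_isPositive A).mp hA).inner_nonneg_right y
    rw [hy, inner_neg_right, inner_smul_right, inner_self_eq_norm_sq_to_K, neg_nonneg] at hpos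
    have hle : s * ‖y‖ ^ 2 ≤ 0 := Complex.real_le_real.mp (by push_cast; exact hpos)
    have hy0 : ‖y‖ ^ 2 = 0 := (nonpos_of_mul_nonpos_right hle hs).antisymm (sq_nonneg _)
    exact sub_eq_zero.mp (norm_eq_zero.mp (sq_eq_zero_iff.mp hy0))

theorem IsTraceClass.summable_of_star_mul_self_apply (hT : IsTraceClass T) {κ : Type*} {p : κ → H}
    (hp : Orthonormal ℂ p) {s : κ → ℝ} (hs : ∀ k, 0 ≤ s k)
    (hps : ∀ k, (star T * T) (p k) = (s k : ℂ) ^ 2 • p k) : Summable s := by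
  refine (hT.summable_re_inner_abs hp).congr fun k => ?_
  have habs : CFC.abs T (p k) = (s k : ℂ) • p k := by
    refine apply_eq_smul_of_apply_apply_eq_sq_smul (CFC.abs_nonneg T) (hs k) ?_
    rw [← mul_apply_eq_comp, CFC.abs_mul_abs, hps]
  rw [habs, inner_smul_right, inner_self_eq_norm_sq_to_K, hp.1]
  simp

end TraceClass

/-! ### Principal vectors of a pair of projections -/

theorem orthogonal_span_range_sigma_eq_bot {𝕜 E ι : Type*} [RCLike 𝕜] [NormedAddCommGroup E]
    [InnerProductSpace 𝕜 E] {V : ι → Submodule 𝕜 E} (hV : (⨆ i, V i)ᗮ = ⊥) {s : ι → Type*}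
    (b : ∀ i, HilbertBasis (s i) 𝕜 (V i)) :
    (Submodule.span 𝕜 (Set.range fun a : Σ i, s i => (b a.1 a.2 : E)))ᗮ = ⊥ := by
  rw [eq_bot_iff, ← hV, ← Submodule.orthogonal_closure]
  refine Submodule.orthogonal_le (iSup_le fun i x hx => ?_)
  have hsum : HasSum (fun k => (b i).repr ⟨x, hx⟩ k • (b i k : E)) x :=
    ((b i).hasSum_repr ⟨x, hx⟩).mapL (V i).subtypeL
  exact mem_closure_of_tendsto hsum <| .of_forall fun t => Submodule.sum_mem _ fun k _ =>
    Submodule.smul_mem _ _ (Submodule.subset_span ⟨⟨i, k⟩, rfl⟩)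

theorem exists_hilbertBasis_apply_eq_smul.{v, w} {𝕜 : Type v} {E : Type w} [RCLike 𝕜]
    [NormedAddCommGroup E] [InnerProductSpace 𝕜 E] [CompleteSpace E] {T : E →L[𝕜] E}
    (hT : IsCompactOperator T) (hT' : T.IsSymmetric) :
    ∃ (κ : Type max v w) (b : HilbertBasis κ 𝕜 E) (μ : κ → 𝕜), ∀ k, T (b k) = μ k • b k := by
  let V (μ : 𝕜) : Submodule 𝕜 E := Module.End.eigenspace (T : Module.End 𝕜 E) μ
  have hVmem {μ : 𝕜} {x : E} : x ∈ V μ ↔ T x = μ • x := Module.End.mem_eigenspace_iff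
  have (μ : 𝕜) : CompleteSpace (V μ) := by
    have hset : (V μ : Set E) = {x | T x = μ • x} := Set.ext fun _ => hVmem
    have hclosed : IsClosed (V μ : Set E) :=
      hset ▸ isClosed_eq T.continuous (continuous_const_smul μ)
    exact hclosed.completeSpace_coe
  choose s b _ using fun μ => exists_hilbertBasis 𝕜 (V μ)
  have hortho : Orthonormal 𝕜 fun a : Σ μ, s μ => (b a.1 a.2 : E) :=
    hT'.orthogonalFamily_eigenspaces.orthonormal_sigma_orthonormal fun μ => (b μ).orthonormal
  have htotal := orthogonal_span_range_sigma_eq_bot (V := V)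
    (ContinuousLinearMap.orthogonalComplement_iSup_eigenspaces_eq_bot hT hT') b
  refine ⟨Σ μ, s μ, .mkOfOrthogonalEqBot hortho htotal, fun a => a.1, fun a => ?_⟩
  rw [HilbertBasis.coe_mkOfOrthogonalEqBot]
  exact hVmem.mp (b a.1 a.2).2

theorem norm_sub_le_sqrt_two_mul_sqrt {E : Type*} [NormedAddCommGroup E] [InnerProductSpace ℂ E]
    {x y : E} (hx : ‖x‖ = 1) (hy : ‖y‖ = 1) {c : ℝ} (hc : 0 ≤ c) (hxy : ⟪x, y⟫_ℂ = c) :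
    ‖x - y‖ ≤ √2 * √(1 - c ^ 2) := by
  have hc1 : c ≤ 1 := by
    simpa [hxy, hx, hy, abs_of_nonneg hc] using norm_inner_le_norm (𝕜 := ℂ) x y
  rw [← Real.sqrt_mul zero_le_two]
  refine Real.le_sqrt_of_sq_le ?_
  rw [norm_sub_sq (𝕜 := ℂ), hx, hy, hxy, RCLike.re_to_complex, Complex.ofReal_re]
  nlinarith [mul_nonneg hc (sub_nonneg.mpr hc1)]

section PairOfProjections

variable {H : Type u} [NormedAddCommGroup H] [InnerProductSpace ℂ H] [CompleteSpace H]
  {Q Q₁ Q₂ : H →L[ℂ] H} {κ : Type*} {p : κ → H}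

theorem completeSpace_range_of_isStarProjection (hQ : IsStarProjection Q) :
    CompleteSpace Q.range :=
  (ContinuousLinearMap.IsIdempotentElem.isClosed_range hQ.isIdempotentElem).completeSpace_coe

theorem isStarProjection_apply_coe (hQ : IsStarProjection Q) (x : Q.range) : Q x = x :=
  (LinearMap.IsIdempotentElem.mem_range_iff
    (ContinuousLinearMap.IsIdempotentElem.toLinearMap hQ.isIdempotentElem)).mp x.2

theorem hasSum_inner_smul_hilbertBasis_range (hQ : IsStarProjection Q)
    (b : HilbertBasis κ ℂ Q.range) (x : H) :
    HasSum (fun k => ⟪(b k : H), x⟫_ℂ • (b k : H)) (Q x) := by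
  have hsum := (b.hasSum_repr ⟨Q x, x, rfl⟩).mapL Q.range.subtypeL
  have hcoeff (k : κ) : ⟪(b k : H), Q x⟫_ℂ = ⟪(b k : H), x⟫_ℂ := by
    rw [← isStarProjection_inner_left hQ, isStarProjection_apply_coe hQ]
  simpa only [map_smul, b.repr_apply_apply, Submodule.coe_inner, hcoeff,
    Submodule.subtypeL_apply] using hsum

theorem hasSum_inner_smul_of_total (hQ : IsStarProjection Q) (hp : Orthonormal ℂ p)
    (hQp : ∀ k, Q (p k) = p k) (htotal : ∀ x, Q x = x → (∀ k, ⟪p k, x⟫_ℂ = 0) → x = 0) (x : H) :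
    HasSum (fun k => ⟪p k, x⟫_ℂ • p k) (Q x) := by
  have := completeSpace_range_of_isStarProjection hQ
  let v (k : κ) : Q.range := ⟨p k, p k, hQp k⟩
  have hv : Orthonormal ℂ v := ⟨fun k => hp.1 k, fun k l hkl => hp.2 hkl⟩
  have hspan : (Submodule.span ℂ (Set.range v))ᗮ = ⊥ := by
    refine (Submodule.eq_bot_iff _).mpr fun y hy => Subtype.ext ?_
    refine htotal y (isStarProjection_apply_coe hQ y) fun k => ?_
    exact hy (v k) (Submodule.subset_span ⟨k, rfl⟩)
  simpa only [HilbertBasis.coe_mkOfOrthogonalEqBot] using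
    hasSum_inner_smul_hilbertBasis_range hQ (.mkOfOrthogonalEqBot hv hspan) x

theorem isSymmetric_sub_mul_mul (hQ₁ : IsStarProjection Q₁) (hQ₂ : IsStarProjection Q₂) :
    (Q₁ - Q₁ * Q₂ * Q₁).IsSymmetric := by
  refine (hQ₁.isSelfAdjoint.sub ?_).isSymmetric
  simpa only [hQ₁.isSelfAdjoint.star_eq] using hQ₂.isSelfAdjoint.conjugate Q₁

theorem exists_orthonormal_apply_apply_eq_smul (hQ₁ : IsStarProjection Q₁)
    (hQ₂ : IsStarProjection Q₂) (hc : IsCompactOperator (Q₁ - Q₁ * Q₂ * Q₁)) :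
    ∃ (κ : Type u) (p : κ → H), Orthonormal ℂ p ∧ (∀ k, Q₁ (p k) = p k) ∧
      (∀ k, Q₁ (Q₂ (p k)) = (‖Q₂ (p k)‖ : ℂ) ^ 2 • p k) ∧
      ∀ x, HasSum (fun k => ⟪p k, x⟫_ℂ • p k) (Q₁ x) := by
  have := completeSpace_range_of_isStarProjection hQ₁
  set T := Q₁ - Q₁ * Q₂ * Q₁ with hT
  have hmaps : ∀ x ∈ Q₁.range, T x ∈ Q₁.range := fun x _ => ⟨x - Q₂ (Q₁ x), by simp [hT]⟩
  obtain ⟨κ, b, μ, hb⟩ := exists_hilbertBasis_apply_eq_smul (T := T.restrict hmaps)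
    (hc.restrict' hmaps) ((isSymmetric_sub_mul_mul hQ₁ hQ₂).restrict_invariant hmaps)
  have hQ₁b (k : κ) : Q₁ (b k) = b k := isStarProjection_apply_coe hQ₁ _
  have hortho : Orthonormal ℂ fun k => (b k : H) :=
    b.orthonormal.comp_linearIsometry Q₁.range.subtypeₗᵢ
  have heigen (k : κ) : Q₁ (Q₂ (b k)) = (1 - μ k) • (b k : H) := by
    have hTb : T (b k) = μ k • (b k : H) := congrArg Subtype.val (hb k)
    rw [sub_smul, one_smul, ← hTb, hT]
    simp [hQ₁b]
  have hsq (k : κ) : (‖Q₂ (b k)‖ : ℂ) ^ 2 = 1 - μ k := by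
    calc (‖Q₂ (b k)‖ : ℂ) ^ 2
      _ = ⟪Q₂ (b k), Q₂ (b k)⟫_ℂ := by
        simp only [inner_self_eq_norm_sq_to_K, Complex.coe_algebraMap]
      _ = ⟪(b k : H), Q₁ (Q₂ (b k))⟫_ℂ := by
        rw [isStarProjection_inner_left hQ₂, isStarProjection_apply_apply hQ₂,
          ← isStarProjection_inner_left hQ₁, hQ₁b]
      _ = 1 - μ k := by
        rw [heigen, inner_smul_right, inner_self_eq_norm_sq_to_K, hortho.1]
        simp
  exact ⟨κ, fun k => b k, hortho, hQ₁b, fun k => by rw [hsq, heigen],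
    hasSum_inner_smul_hilbertBasis_range hQ₁ b⟩

/-- An orthonormal system `p` of *principal vectors* of the projection `Q₁` relative to `Q₂`:
eigenvectors of `Q₁ Q₂` in the range of `Q₁`. The eigenvalue `‖Q₂ (p k)‖ ^ 2`, the squared cosine
of the principal angle, is required to be nonzero. -/
structure IsPrincipalSystem (Q₁ Q₂ : H →L[ℂ] H) (p : κ → H) : Prop where
  orthonormal : Orthonormal ℂ p
  apply_left (k : κ) : Q₁ (p k) = p k
  apply_apply (k : κ) : Q₁ (Q₂ (p k)) = (‖Q₂ (p k)‖ : ℂ) ^ 2 • p k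
  apply_right_ne_zero (k : κ) : Q₂ (p k) ≠ 0

/-- The direction of `Q x`. For a principal vector `x` of a projection relative to `Q` this is
the principal vector of `Q` paired with `x`. It is `0` if `Q x = 0`. -/
def principalPartner (Q : H →L[ℂ] H) (x : H) : H := (‖Q x‖ : ℂ)⁻¹ • Q x

theorem apply_principalPartner (hQ : IsStarProjection Q) (x : H) :
    Q (principalPartner Q x) = principalPartner Q x := by
  rw [principalPartner, map_smul, isStarProjection_apply_apply hQ]

namespace IsPrincipalSystem

theorem inner_principalPartner (hp : IsPrincipalSystem Q₁ Q₂ p) (hQ₁ : IsStarProjection Q₁)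
    (k l : κ) : ⟪p k, principalPartner Q₂ (p l)⟫_ℂ = ‖Q₂ (p l)‖ * ⟪p k, p l⟫_ℂ := by
  have hne : (‖Q₂ (p l)‖ : ℂ) ≠ 0 := mod_cast norm_ne_zero_iff.mpr (hp.apply_right_ne_zero l)
  rw [principalPartner, inner_smul_right, ← hp.apply_left k, isStarProjection_inner_left hQ₁,
    hp.apply_apply, inner_smul_right, hp.apply_left]
  field_simp

theorem orthonormal_principalPartner (hp : IsPrincipalSystem Q₁ Q₂ p)
    (hQ₁ : IsStarProjection Q₁) (hQ₂ : IsStarProjection Q₂) :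
    Orthonormal ℂ fun k => principalPartner Q₂ (p k) := by
  refine ⟨fun k => ?_, fun k l hkl => ?_⟩
  · change ‖(‖Q₂ (p k)‖ : ℂ)⁻¹ • Q₂ (p k)‖ = 1
    rw [norm_smul, norm_inv, Complex.norm_real, norm_norm,
      inv_mul_cancel₀ (norm_ne_zero_iff.mpr (hp.apply_right_ne_zero k))]
  · change ⟪(‖Q₂ (p k)‖ : ℂ)⁻¹ • Q₂ (p k), principalPartner Q₂ (p l)⟫_ℂ = 0
    rw [inner_smul_left, isStarProjection_inner_left hQ₂, apply_principalPartner hQ₂,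
      hp.inner_principalPartner hQ₁, hp.orthonormal.2 hkl, mul_zero, mul_zero]

theorem isPrincipalFamily (hp : IsPrincipalSystem Q₁ Q₂ p) (hQ₁ : IsStarProjection Q₁)
    (hQ₂ : IsStarProjection Q₂) :
    IsPrincipalFamily Q₁ p fun k => principalPartner Q₂ (p k) where
  orthonormal_left := hp.orthonormal
  orthonormal_right := hp.orthonormal_principalPartner hQ₁ hQ₂
  apply_left := hp.apply_left
  apply_right k := by
    rw [hp.inner_principalPartner hQ₁, inner_self_eq_norm_sq_to_K, hp.orthonormal.1]
    have hne : (‖Q₂ (p k)‖ : ℂ) ≠ 0 := mod_cast norm_ne_zero_iff.mpr (hp.apply_right_ne_zero k)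
    rw [principalPartner, map_smul, hp.apply_apply, smul_smul]
    congr 1
    simp only [Complex.coe_algebraMap, Complex.ofReal_one]
    field_simp

theorem hasSum_principalPartner (hp : IsPrincipalSystem Q₁ Q₂ p) (hQ₁ : IsStarProjection Q₁)
    (hQ₂ : IsStarProjection Q₂) (hgen : ∀ x, Q₂ x = x → Q₁ x = 0 → x = 0)
    (hsum : ∀ x, HasSum (fun k => ⟪p k, x⟫_ℂ • p k) (Q₁ x)) (x : H) :
    HasSum (fun k => ⟪principalPartner Q₂ (p k), x⟫_ℂ • principalPartner Q₂ (p k)) (Q₂ x) := by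
  refine hasSum_inner_smul_of_total hQ₂ (hp.orthonormal_principalPartner hQ₁ hQ₂)
    (fun k => apply_principalPartner hQ₂ _) (fun y hy hortho => hgen y hy ?_) x
  have hpy (k : κ) : ⟪p k, y⟫_ℂ = 0 := by
    have h := hortho k
    rw [principalPartner, inner_smul_left, isStarProjection_inner_left hQ₂, hy] at h
    exact (mul_eq_zero.mp h).resolve_left (by simpa using hp.apply_right_ne_zero k)
  have hzero : HasSum (fun k => ⟪p k, y⟫_ℂ • p k) 0 := by
    simpa only [hpy, zero_smul] using hasSum_zero
  exact (hsum y).unique hzero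

theorem norm_sub_principalPartner_le (hp : IsPrincipalSystem Q₁ Q₂ p)
    (hQ₁ : IsStarProjection Q₁) (hQ₂ : IsStarProjection Q₂) (k : κ) :
    ‖p k - principalPartner Q₂ (p k)‖ ≤ √2 * √(1 - ‖Q₂ (p k)‖ ^ 2) := by
  refine norm_sub_le_sqrt_two_mul_sqrt (hp.orthonormal.1 k)
    ((hp.orthonormal_principalPartner hQ₁ hQ₂).1 k) (norm_nonneg _) ?_
  rw [hp.inner_principalPartner hQ₁, inner_self_eq_norm_sq_to_K, hp.orthonormal.1]
  simp

theorem summable_norm_sub_principalPartner (hp : IsPrincipalSystem Q₁ Q₂ p)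
    (hQ₁ : IsStarProjection Q₁) (hQ₂ : IsStarProjection Q₂) {T : H →L[ℂ] H} (hT : IsTraceClass T)
    (hTQ : star T * T * Q₁ = Q₁ - Q₁ * Q₂ * Q₁) :
    Summable fun k => ‖p k - principalPartner Q₂ (p k)‖ := by
  refine .of_nonneg_of_le (fun _ => norm_nonneg _) (hp.norm_sub_principalPartner_le hQ₁ hQ₂)
    ((hT.summable_of_star_mul_self_apply hp.orthonormal (fun _ => Real.sqrt_nonneg _)
      fun k => ?_).mul_left √2)
  have hle : ‖Q₂ (p k)‖ ≤ 1 := by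
    simpa [hp.orthonormal.1 k] using Q₂.le_of_opNorm_le hQ₂.norm_le (p k)
  have hsq : (√(1 - ‖Q₂ (p k)‖ ^ 2) : ℂ) ^ 2 = 1 - (‖Q₂ (p k)‖ : ℂ) ^ 2 := by
    have := Real.sq_sqrt (sub_nonneg.mpr (pow_le_one₀ (n := 2) (norm_nonneg _) hle))
    exact_mod_cast this
  calc (star T * T) (p k) = (star T * T * Q₁) (p k) := by
        rw [mul_apply_eq_comp _ Q₁, hp.apply_left]
    _ = p k - (‖Q₂ (p k)‖ : ℂ) ^ 2 • p k := by
        rw [hTQ, ← hp.apply_apply]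
        simp [hp.apply_left]
    _ = _ := by rw [hsq, sub_smul, one_smul]

end IsPrincipalSystem

theorem exists_isPrincipalFamily (hQ₁ : IsStarProjection Q₁) (hQ₂ : IsStarProjection Q₂)
    (hgen₁ : ∀ x, Q₁ x = x → Q₂ x = 0 → x = 0) (hgen₂ : ∀ x, Q₂ x = x → Q₁ x = 0 → x = 0)
    {T : H →L[ℂ] H} (hT : IsTraceClass T) (hTQ : star T * T * Q₁ = Q₁ - Q₁ * Q₂ * Q₁) :
    ∃ (κ : Type u) (p q : κ → H), IsPrincipalFamily Q₁ p q ∧ (Summable fun k => ‖p k - q k‖) ∧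
      ∀ x, HasSum (fun k => ⟪q k, x⟫_ℂ • q k - ⟪p k, x⟫_ℂ • p k) (Q₂ x - Q₁ x) := by
  have hcompact : IsCompactOperator (Q₁ - Q₁ * Q₂ * Q₁) :=
    hTQ ▸ hT.isCompactOperator_star_mul_self.comp_clm Q₁
  obtain ⟨κ, p, hortho, hleft, heigen, hsum⟩ :=
    exists_orthonormal_apply_apply_eq_smul hQ₁ hQ₂ hcompact
  have hp : IsPrincipalSystem Q₁ Q₂ p :=
    ⟨hortho, hleft, heigen, fun k hk => hortho.ne_zero k (hgen₁ _ (hleft k) hk)⟩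
  exact ⟨κ, p, _, hp.isPrincipalFamily hQ₁ hQ₂,
    hp.summable_norm_sub_principalPartner hQ₁ hQ₂ hT hTQ,
    fun x => (hp.hasSum_principalPartner hQ₁ hQ₂ hgen₂ hsum x).sub (hsum x)⟩

end PairOfProjections

/-! ### The Fredholm operator of a pair of projections -/

theorem isFredholm_of_isFredholm_comp {𝕜 E F : Type*} [NontriviallyNormedField 𝕜]
    [CompleteSpace 𝕜] [NormedAddCommGroup E] [NormedSpace 𝕜 E] [NormedAddCommGroup F]
    [NormedSpace 𝕜 F] {T : E →L[𝕜] F} {S : F →L[𝕜] E} (hST : (S ∘L T).IsFredholm)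
    (hTS : (T ∘L S).IsFredholm) : T.IsFredholm := by
  obtain ⟨V, hV⟩ := hST.exists_isQuasiInverse
  obtain ⟨W, hW⟩ := hTS.exists_isQuasiInverse
  have hS : LinearMap.IsRightQuasiInverse ((T ∘L V : E →L[𝕜] F) : E →ₗ[𝕜] F)
      (S : F →ₗ[𝕜] E) := hV.2
  exact .of_isQuasiInverse (v := S ∘L W) ⟨.of_comp_left hS hW.1, hW.2⟩

theorem isFredholm_one_sub_of_isCompactOperator {𝕜 E : Type*} [RCLike 𝕜] [NormedAddCommGroup E]
    [InnerProductSpace 𝕜 E] [CompleteSpace E] {K : E →L[𝕜] E} (hK : IsCompactOperator K)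
    (hK' : K.IsSymmetric) : (1 - K).IsFredholm := by
  let N : Submodule 𝕜 E := Module.End.eigenspace (K : Module.End 𝕜 E) 1
  have : FiniteDimensional 𝕜 N :=
    ContinuousLinearMap.finite_dimensional_eigenspace hK 1 one_ne_zero
  have hmaps : ∀ x ∈ Nᗮ, K x ∈ Nᗮ := hK'.invariant_orthogonalComplement_eigenspace 1
  have hcoFG : Nᗮ.CoFG := Module.Finite.equiv
    (Submodule.quotientEquivOfIsCompl _ _ (Submodule.isCompl_orthogonal (K := N)).symm).symm
  have hno : ¬ Module.End.HasEigenvalue ((K.restrict hmaps : Nᗮ →L[𝕜] Nᗮ) : Module.End 𝕜 Nᗮ) 1 := by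
    intro h
    obtain ⟨x, hx⟩ := h.exists_hasEigenvector
    have hxN : (x : E) ∈ N :=
      Module.End.mem_eigenspace_iff.mpr (congrArg Subtype.val hx.apply_eq_smul)
    exact hx.2 (Subtype.ext (inner_self_eq_zero.mp (x.2 x hxN)))
  have hunit : IsUnit (1 - K.restrict hmaps : Nᗮ →L[𝕜] Nᗮ) := by
    simpa [spectrum.mem_resolventSet_iff] using
      ((hK.restrict' hmaps).hasEigenvalue_or_mem_resolventSet one_ne_zero).resolve_left hno
  have hmaps' : ∀ x ∈ Nᗮ, (1 - K) x ∈ Nᗮ := fun x hx => Nᗮ.sub_mem hx (hmaps x hx)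
  obtain ⟨U, hU⟩ := hunit
  exact .of_isInvertible_restrict N.isClosed_orthogonal N.isClosed_orthogonal hmaps'
    ⟨ContinuousLinearEquiv.unitsEquiv 𝕜 Nᗮ U, hU⟩

section StarRing

variable {R : Type*} [NonUnitalRing R] [StarRing R]

theorem star_sub_mul_sub_comm (a b : R) : star (a - b) * (a - b) = star (b - a) * (b - a) := by
  rw [← neg_sub b a, star_neg, neg_mul_neg]

theorem star_sub_mul_sub_mul {p q : R} (hp : IsStarProjection p) (hq : IsStarProjection q) :
    star (p - q) * (p - q) * p = p - p * q * p := by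
  rw [(hp.isSelfAdjoint.sub hq.isSelfAdjoint).star_eq]
  simp only [sub_mul, mul_sub, hp.isIdempotentElem.eq, hq.isIdempotentElem.eq]
  rw [mul_assoc q p p, hp.isIdempotentElem.eq]
  abel

end StarRing

section PairOperator

variable {H : Type u} [NormedAddCommGroup H] [InnerProductSpace ℂ H] [CompleteSpace H]
  {P₁ P₂ : H →L[ℂ] H}

theorem isFredholm_pairOperator_comp_pairOperator (hP₁ : IsStarProjection P₁)
    (hP₂ : IsStarProjection P₂) (hc : IsCompactOperator (star (P₁ - P₂) * (P₁ - P₂))) :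
    (pairOperator P₂ P₁ ∘L pairOperator P₁ P₂).IsFredholm := by
  have := completeSpace_range_of_isStarProjection hP₁
  have hmaps : ∀ x ∈ P₁.range, (P₁ - P₁ * P₂ * P₁) x ∈ P₁.range :=
    fun x _ => ⟨x - P₂ (P₁ x), by simp⟩
  have hcompact : IsCompactOperator (P₁ - P₁ * P₂ * P₁) :=
    star_sub_mul_sub_mul hP₁ hP₂ ▸ hc.comp_clm P₁
  have hcomp : pairOperator P₂ P₁ ∘L pairOperator P₁ P₂ =
      1 - (P₁ - P₁ * P₂ * P₁).restrict hmaps := by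
    ext x
    change P₁ (P₂ (P₂ (P₁ x))) = (x : H) - (P₁ x - P₁ (P₂ (P₁ x)))
    rw [isStarProjection_apply_apply hP₂, isStarProjection_apply_coe hP₁, sub_sub_cancel]
  exact hcomp ▸ isFredholm_one_sub_of_isCompactOperator (hcompact.restrict' hmaps)
    ((isSymmetric_sub_mul_mul hP₁ hP₂).restrict_invariant hmaps)

theorem isFredholm_pairOperator (hP₁ : IsStarProjection P₁) (hP₂ : IsStarProjection P₂)
    (hc : IsCompactOperator (star (P₁ - P₂) * (P₁ - P₂))) : (pairOperator P₁ P₂).IsFredholm := by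
  have hc' : IsCompactOperator (star (P₂ - P₁) * (P₂ - P₁)) := star_sub_mul_sub_comm P₁ P₂ ▸ hc
  exact isFredholm_of_isFredholm_comp (isFredholm_pairOperator_comp_pairOperator hP₁ hP₂ hc)
    (isFredholm_pairOperator_comp_pairOperator hP₂ hP₁ hc')

end PairOperator

/-! ### The index of a pair of quasi-free states -/

section FredholmIndex

variable {H : Type u} [NormedAddCommGroup H] [InnerProductSpace ℂ H] [CompleteSpace H]
  {P₁ P₂ : H →L[ℂ] H}

theorem map_subtype_ker_pairOperator (hP₁ : IsStarProjection P₁) :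
    (pairOperator P₁ P₂).ker.map P₁.range.subtype = P₁.range ⊓ P₂.ker := by
  have hker (x : P₁.range) : x ∈ (pairOperator P₁ P₂).ker ↔ P₂ x = 0 := by
    rw [LinearMap.mem_ker, ← Subtype.coe_inj]
    change P₂ (P₁ x) = 0 ↔ _
    rw [isStarProjection_apply_coe hP₁]
  ext x
  constructor
  · rintro ⟨y, hy, rfl⟩
    exact ⟨y.2, (hker y).mp hy⟩
  · exact fun hx => ⟨⟨x, hx.1⟩, (hker ⟨x, hx.1⟩).mpr hx.2, rfl⟩

theorem orthogonal_range_pairOperator (hP₁ : IsStarProjection P₁) (hP₂ : IsStarProjection P₂) :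
    (pairOperator P₁ P₂).rangeᗮ = (pairOperator P₂ P₁).ker := by
  have := completeSpace_range_of_isStarProjection hP₁
  have := completeSpace_range_of_isStarProjection hP₂
  rw [ContinuousLinearMap.orthogonal_range,
    (ContinuousLinearMap.eq_adjoint_iff (pairOperator P₂ P₁) (pairOperator P₁ P₂)).mpr]
  intro y x
  change ⟪P₁ (P₂ y), (x : H)⟫_ℂ = ⟪(y : H), P₂ (P₁ x)⟫_ℂ
  rw [isStarProjection_inner_left hP₁, isStarProjection_inner_left hP₂]

theorem finrank_ker_pairOperator (hP₁ : IsStarProjection P₁) :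
    Module.finrank ℂ (pairOperator P₁ P₂).ker = Module.finrank ℂ ↥(P₁.range ⊓ P₂.ker) := by
  rw [← map_subtype_ker_pairOperator hP₁, Submodule.finrank_map_subtype_eq]

theorem finiteDimensional_range_inf_ker (hP₁ : IsStarProjection P₁)
    (hT : (pairOperator P₁ P₂).IsFredholm) : FiniteDimensional ℂ ↥(P₁.range ⊓ P₂.ker) := by
  have := hT.finite_ker
  rw [← map_subtype_ker_pairOperator hP₁]
  infer_instance

theorem fredholmIndex_pairOperator (hP₁ : IsStarProjection P₁) (hP₂ : IsStarProjection P₂)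
    (hT : (pairOperator P₁ P₂).IsFredholm) :
    fredholmIndex (pairOperator P₁ P₂) =
      (Module.finrank ℂ ↥(P₁.range ⊓ P₂.ker) : ℤ) - Module.finrank ℂ ↥(P₂.range ⊓ P₁.ker) := by
  have := completeSpace_range_of_isStarProjection hP₂
  have : CompleteSpace (pairOperator P₁ P₂).range := hT.isClosed_range.completeSpace_coe
  have hcoker := (Submodule.quotientEquivOfIsCompl _ _
    (Submodule.isCompl_orthogonal (K := (pairOperator P₁ P₂).range))).finrank_eq
  rw [fredholmIndex, hcoker, orthogonal_range_pairOperator hP₁ hP₂, finrank_ker_pairOperator hP₁,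
    finrank_ker_pairOperator hP₂]

end FredholmIndex

section GenericPart

variable {H : Type u} [NormedAddCommGroup H] [InnerProductSpace ℂ H]
  {P₁ P₂ : H →L[ℂ] H}

theorem mul_starProjection_of_le_ker {P : H →L[ℂ] H} {N : Submodule ℂ H}
    [N.HasOrthogonalProjection] (hN : N ≤ P.ker) : P * N.starProjection = 0 := by
  ext x
  exact hN (N.starProjection_apply_mem x)

/-- The part of the projection `P₁` in generic position relative to `P₂`: the vectors of the range
of `P₁` that `P₂` annihilates are removed. -/
def genericPart (P₁ P₂ : H →L[ℂ] H) [(P₁.range ⊓ P₂.ker).HasOrthogonalProjection] : H →L[ℂ] H :=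
  P₁ - (P₁.range ⊓ P₂.ker).starProjection

variable [(P₁.range ⊓ P₂.ker).HasOrthogonalProjection]

theorem mul_genericPart_right : P₂ * genericPart P₁ P₂ = P₂ * P₁ := by
  rw [genericPart, mul_sub, mul_starProjection_of_le_ker inf_le_right, sub_zero]

variable [CompleteSpace H]

theorem mul_starProjection_of_le_range {P : H →L[ℂ] H} (hP : IsStarProjection P)
    {N : Submodule ℂ H} [N.HasOrthogonalProjection] (hN : N ≤ P.range) :
    P * N.starProjection = N.starProjection := by
  ext x
  exact isStarProjection_apply_coe hP ⟨_, hN (N.starProjection_apply_mem x)⟩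

theorem isStarProjection_genericPart (hP₁ : IsStarProjection P₁) :
    IsStarProjection (genericPart P₁ P₂) :=
  isStarProjection_starProjection.sub_of_mul_eq_right hP₁
    (mul_starProjection_of_le_range hP₁ inf_le_left)

theorem mul_genericPart (hP₁ : IsStarProjection P₁) :
    P₁ * genericPart P₁ P₂ = genericPart P₁ P₂ := by
  rw [genericPart, mul_sub, hP₁.isIdempotentElem.eq, mul_starProjection_of_le_range hP₁ inf_le_left]

theorem genericPart_mul (hP₁ : IsStarProjection P₁) :
    genericPart P₁ P₂ * P₁ = genericPart P₁ P₂ := by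
  simpa only [star_mul, hP₁.isSelfAdjoint.star_eq,
    (isStarProjection_genericPart hP₁).isSelfAdjoint.star_eq]
    using congrArg star (mul_genericPart (P₂ := P₂) hP₁)

theorem genericPart_mul_right (hP₁ : IsStarProjection P₁) (hP₂ : IsStarProjection P₂) :
    genericPart P₁ P₂ * P₂ = P₁ * P₂ := by
  simpa only [star_mul, hP₁.isSelfAdjoint.star_eq, hP₂.isSelfAdjoint.star_eq,
    (isStarProjection_genericPart hP₁).isSelfAdjoint.star_eq]
    using congrArg star (mul_genericPart_right (P₁ := P₁) (P₂ := P₂))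

variable [(P₂.range ⊓ P₁.ker).HasOrthogonalProjection]

theorem genericPart_mul_genericPart (hP₁ : IsStarProjection P₁) (hP₂ : IsStarProjection P₂) :
    genericPart P₁ P₂ * genericPart P₂ P₁ = P₁ * P₂ := by
  rw [← genericPart_mul hP₁, mul_assoc, mul_genericPart_right, ← mul_assoc, genericPart_mul hP₁,
    genericPart_mul_right hP₁ hP₂]

theorem eq_zero_of_genericPart (hP₁ : IsStarProjection P₁) (hP₂ : IsStarProjection P₂) {x : H}
    (hx₁ : genericPart P₁ P₂ x = x) (hx₂ : genericPart P₂ P₁ x = 0) : x = 0 := by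
  have hP₁x : P₁ x = x := by
    simpa only [mul_apply_eq_comp, hx₁] using
      DFunLike.congr_fun (mul_genericPart (P₂ := P₂) hP₁) x
  have hP₂x : P₂ x = 0 := by
    have h := DFunLike.congr_fun (genericPart_mul_right hP₂ hP₁) x
    rwa [mul_apply_eq_comp, mul_apply_eq_comp, hP₁x, hx₂, eq_comm] at h
  have hmem : (P₁.range ⊓ P₂.ker).starProjection x = x :=
    Submodule.starProjection_eq_self_iff.mpr ⟨⟨x, hP₁x⟩, hP₂x⟩
  rw [← hx₁, genericPart, sub_apply, hP₁x, hmem, sub_self]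

theorem star_sub_mul_sub_mul_genericPart (hP₁ : IsStarProjection P₁) (hP₂ : IsStarProjection P₂) :
    star (P₁ - P₂) * (P₁ - P₂) * genericPart P₁ P₂ =
      genericPart P₁ P₂ - genericPart P₁ P₂ * genericPart P₂ P₁ * genericPart P₁ P₂ := by
  rw [genericPart_mul_genericPart hP₁ hP₂, ← mul_genericPart hP₁, ← mul_assoc,
    star_sub_mul_sub_mul hP₁ hP₂, sub_mul, mul_assoc (P₁ * P₂) P₁]

end GenericPart

section Index

variable {H : Type u} [NormedAddCommGroup H] [InnerProductSpace ℂ H] [CompleteSpace H]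
  {P P₁ P₂ : H →L[ℂ] H} {ω ω' ω₁ ω₂ : CAR H →L[ℂ] ℂ}

theorem IsQuasiFree.nonempty_chargedIntertwiners_sub_starProjection (h : IsQuasiFree P ω)
    (hP : IsStarProjection P) {N : Submodule ℂ H} [FiniteDimensional ℂ N] (hN : N ≤ P.range)
    (h' : IsQuasiFree (P - N.starProjection) ω') :
    ((CAR.charge H).chargedIntertwiners ω ω' (Module.finrank ℂ N)).Nonempty := by
  let b := stdOrthonormalBasis ℂ N
  have hPb (i) : P (b i) = b i := isStarProjection_apply_coe hP ⟨b i, hN (b i).2⟩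
  rw [b.starProjection_eq_sum_rankOne] at h'
  simpa using h.nonempty_chargedIntertwiners_sub_sum_rankOne hP
    (b.orthonormal.comp_linearIsometry N.subtypeₗᵢ) hPb Finset.univ h'

theorem nonempty_chargedIntertwiners_genericPart (hP₁ : IsStarProjection P₁)
    (hP₂ : IsStarProjection P₂) (hP : IsTraceClass (P₁ - P₂))
    [(P₁.range ⊓ P₂.ker).HasOrthogonalProjection] [(P₂.range ⊓ P₁.ker).HasOrthogonalProjection]
    (h₁ : IsQuasiFree (genericPart P₁ P₂) ω₁) (h₂ : IsQuasiFree (genericPart P₂ P₁) ω₂) :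
    ((CAR.charge H).chargedIntertwiners ω₁ ω₂ 0).Nonempty := by
  have hQ₁ := isStarProjection_genericPart (P₂ := P₂) hP₁
  have hQ₂ := isStarProjection_genericPart (P₂ := P₁) hP₂
  obtain ⟨κ, p, q, hpq, hsum, hdiff⟩ := exists_isPrincipalFamily hQ₁ hQ₂
    (fun x => eq_zero_of_genericPart hP₁ hP₂) (fun x => eq_zero_of_genericPart hP₂ hP₁) hP
    (star_sub_mul_sub_mul_genericPart hP₁ hP₂)
  exact hpq.nonempty_chargedIntertwiners hQ₁ hQ₂ hsum hdiff h₁ h₂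

theorem nonempty_chargedIntertwiners_fredholmIndex (hP₁ : IsStarProjection P₁)
    (hP₂ : IsStarProjection P₂) (hP : IsTraceClass (P₁ - P₂)) (h₁ : IsQuasiFree P₁ ω₁)
    (h₂ : IsQuasiFree P₂ ω₂) :
    ((CAR.charge H).chargedIntertwiners ω₁ ω₂
      (fredholmIndex (pairOperator P₁ P₂) : ℂ)).Nonempty := by
  have hc := hP.isCompactOperator_star_mul_self
  have hT := isFredholm_pairOperator hP₁ hP₂ hc
  have := finiteDimensional_range_inf_ker hP₁ hT
  have := finiteDimensional_range_inf_ker hP₂ (isFredholm_pairOperator hP₂ hP₁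
    (star_sub_mul_sub_comm P₁ P₂ ▸ hc))
  obtain ⟨ψ₁, hψ₁, -⟩ := existsUnique_isQuasiFree (isStarProjection_genericPart (P₂ := P₂) hP₁)
  obtain ⟨ψ₂, hψ₂, -⟩ := existsUnique_isQuasiFree (isStarProjection_genericPart (P₂ := P₁) hP₂)
  obtain ⟨u₁, hu₁⟩ := h₁.nonempty_chargedIntertwiners_sub_starProjection hP₁ inf_le_left hψ₁
  obtain ⟨u₂, hu₂⟩ := h₂.nonempty_chargedIntertwiners_sub_starProjection hP₂ inf_le_left hψ₂
  obtain ⟨v, hv⟩ := nonempty_chargedIntertwiners_genericPart hP₁ hP₂ hP hψ₁ hψ₂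
  have h := AutFlow.mul_mem_chargedIntertwiners (AutFlow.star_mem_chargedIntertwiners hu₂)
    (AutFlow.mul_mem_chargedIntertwiners hv hu₁)
  refine ⟨star u₂ * (v * u₁), ?_⟩
  rw [fredholmIndex_pairOperator hP₁ hP₂ hT]
  simpa [sub_eq_add_neg] using h

end Index

end

theorem mainTheorem3 {H : Type u} [NormedAddCommGroup H] [InnerProductSpace ℂ H] [CompleteSpace H]
    (P₁ P₂ : H →L[ℂ] H) (hP₁ : IsStarProjection P₁) (hP₂ : IsStarProjection P₂)
    (hP : IsTraceClass (P₁ - P₂)) :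
    (∃! ω : CAR H →L[ℂ] ℂ, IsQuasiFree P₁ ω) ∧
    (∃! ω : CAR H →L[ℂ] ℂ, IsQuasiFree P₂ ω) ∧
    (pairOperator P₁ P₂).IsFredholm ∧
    ∀ ω₁ ω₂ : CAR H →L[ℂ] ℂ, IsQuasiFree P₁ ω₁ → IsQuasiFree P₂ ω₂ →
      (CAR.charge H).LocallyComparable ω₁ ω₂ ∧
      (CAR.charge H).Invariant ω₁ ∧ (CAR.charge H).Invariant ω₂ ∧
      (∀ u ∈ (CAR.charge H).intertwiners ω₁ ω₂,
        Complex.I * ω₁ (star u * (CAR.charge H).generator u) =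
          (CAR.charge H).index ω₁ ω₂) ∧
      (CAR.charge H).index ω₁ ω₂ = (fredholmIndex (pairOperator P₁ P₂) : ℂ) := by
  refine ⟨existsUnique_isQuasiFree hP₁, existsUnique_isQuasiFree hP₂,
    isFredholm_pairOperator hP₁ hP₂ hP.isCompactOperator_star_mul_self, fun ω₁ ω₂ h₁ h₂ => ?_⟩
  have hpure₁ := h₁.mem_pureStates hP₁
  have hpure₂ := h₂.mem_pureStates hP₂
  have hinv₁ := h₁.invariant hP₁
  have hinv₂ := h₂.invariant hP₂
  obtain ⟨u, hu, hcharge⟩ := nonempty_chargedIntertwiners_fredholmIndex hP₁ hP₂ hP h₁ h₂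
  refine ⟨⟨hpure₁, hpure₂, u, hu⟩, hinv₁, hinv₂, fun v hv => ?_, ?_⟩
  · exact (AutFlow.index_eq_charge hpure₁ hinv₁ hv).symm
  · exact (AutFlow.index_eq_charge hpure₁ hinv₁ hu).trans hcharge
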